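/- Let $n,d\ge 2$ and let $\ell=(\ell_1,\dots,\ell_n)$ with all $\ell_i>0$ and $\ell_i\le \ell_n$ for all $i$. A set $I\subset\{1,\dots,n\}$ is *$\ell$-short* if $\sum_{i\in I}\ell_i<\sum_{i\notin I}\ell_i$, and *$\ell$-long* if its complement is $\ell$-short. Let $$\mathcal C_d(\ell)=\Big\{(z_1,\dots,z_{n-1})\in (S^{d-1})^{n-1}\ \Big|\ \sum_{i=1}^{n-1}\ell_i z_i=(-\ell_n,0,\dots,0)\Big\},$$ on which the group $SO(d-1)$ of rotations of $\mathbb R^d$ fixing the first coordinate acts diagonally, and let $F:\mathcal C_d(\ell)\to\mathbb R$, $F(z)=\ell_{n-1}p_1(z_{n-1})+\ell_n$, where $p_1$ is the first coordinate. Let $J\subset\{1,\dots,n-2\}$ be such that $J\cup\{n\}$ is $\ell$-short and $J\cup\{n-1,n\}$ is $\ell$-long. Then there is a unique unit vector $x=(x_1,x_2,0,\dots,0)\in\mathbb R^d$ with $x_1>0$ and $x_2<0$ such that some $z\in\mathcal C_d(\ell)$ has $z_j=x$ for $j\in J$ and $z_j=-x$ for $j\in\{1,\dots,n-2\}\setminus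 J$. Let $S_J\subset\mathcal C_d(\ell)$ be the $SO(d-1)$-orbit of this $z$. Then $S_J$ is a Morse–Bott critical submanifold of $F$ of index $(n-3-|J|)(d-1)$. That is: near $S_J$ the set $\mathcal C_d(\ell)$ is a smooth submanifold of $(\mathbb R^d)^{n-1}$ of dimension $(n-2)(d-1)-1$; $S_J$ is a non-empty compact smooth submanifold of dimension $d-2$ consisting of critical points of $F$; and at each point of $S_J$ the kernel of the Hessian of $F$ is the tangent space of $S_J$, and the maximal dimension of a subspace of the tangent space of $\mathcal C_d(\ell)$ on which the Hessian is negative definite is $(n-3-|J|)(d-1)$. The same holds with the orbit of $z$ under the group $O(d-1)$ of orthogonal maps fixing the first coordinate in place of $S_J$. (The two orbits are equal for $d\ge3$; for $d=2$ the first is a point and the second is a $0$-sphere.) -/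

import Mathlib

open Set Filter Topology
open scoped ContDiff

noncomputable section

/-! ### Submanifolds of a vector space and Morse-Bott critical submanifolds -/

section MorseBott

variable {E : Type*} [NormedAddCommGroup E] [NormedSpace ℝ E]

/-- Near its point `p`, the set `M` is a smooth embedded submanifold of `E` of dimension `k`:
some smooth chart of `E` around `p` straightens `M` to a `k`-dimensional linear subspace. -/
def IsSubmanifoldAt (M : Set E) (k : ℤ) (p : E) : Prop :=
  p ∈ M ∧ ∃ (Φ : OpenPartialHomeomorph E E) (V : Submodule ℝ E),
    p ∈ Φ.source ∧ ContDiffOn ℝ ∞ Φ Φ.source ∧ ContDiffOn ℝ ∞ Φ.symm Φ.target ∧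
    (Module.finrank ℝ V : ℤ) = k ∧ ∀ q ∈ Φ.source, q ∈ M ↔ Φ q ∈ V

/-- `γ` is (near time `0`) a smooth curve in `M` that passes through `p` at time `0`. -/
def IsCurveThrough (M : Set E) (p : E) (γ : ℝ → E) : Prop :=
  ContDiffAt ℝ ∞ γ 0 ∧ γ 0 = p ∧ ∀ᶠ t in 𝓝 (0 : ℝ), γ t ∈ M

/-- The vectors tangent to `M` at `p`: the velocities of the smooth curves in `M` through `p`.
If `M` is a submanifold near `p`, this is the tangent space of `M` at `p`. -/
def tangentVectors (M : Set E) (p : E) : Set E :=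
  {v | ∃ γ : ℝ → E, IsCurveThrough M p γ ∧ HasDerivAt γ v 0}

/-- `p` is a critical point of the restriction of `f` to `M`: the differential of `f` at `p`
vanishes on the tangent space of `M`. -/
def IsCriticalPointOn (M : Set E) (f : E → ℝ) (p : E) : Prop :=
  ∀ γ : ℝ → E, IsCurveThrough M p γ → HasDerivAt (fun t => f (γ t)) 0 0

/-- `H` is the Hessian, at the critical point `p`, of the restriction of `f` to `M`: the symmetric
bilinear form on the tangent space `T` of `M` at `p` such that `(f ∘ γ)''(0) = H (γ'(0), γ'(0))`
for every smooth curve `γ` in `M` through `p`. -/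
def IsHessianOn (M : Set E) (f : E → ℝ) (p : E) (T : Submodule ℝ E)
    (H : LinearMap.BilinForm ℝ T) : Prop :=
  (T : Set E) = tangentVectors M p ∧ (∀ v w : T, H v w = H w v) ∧
    ∀ (γ : ℝ → E) (v : T), IsCurveThrough M p γ → HasDerivAt γ (v : E) 0 →
      HasDerivAt (deriv fun t => f (γ t)) (H v v) 0

/-- `S` is a Morse-Bott critical submanifold of the restriction of `f` to `M`, of index `ind`.
Near `S` the set `M` is a `k`-dimensional submanifold, `S` is a compact `s`-dimensional submanifold
contained in `M`, every point of `S` is a critical point, and at every point of `S` the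
kernel of the Hessian is exactly the tangent space of `S` (so that the Hessian is nondegenerate
in the normal directions) and the maximal dimension of a subspace on which the Hessian is negative
definite is `ind`. -/
def IsMorseBottCritical (M : Set E) (f : E → ℝ) (S : Set E) (k s ind : ℤ) : Prop :=
  S ⊆ M ∧ IsCompact S ∧ S.Nonempty ∧
    ∀ p ∈ S, IsSubmanifoldAt M k p ∧ IsSubmanifoldAt S s p ∧ IsCriticalPointOn M f p ∧
      ∃ (T : Submodule ℝ E) (H : LinearMap.BilinForm ℝ T), IsHessianOn M f p T H ∧
        (∀ v : T, (∀ w : T, H v w = 0) ↔ (v : E) ∈ tangentVectors S p) ∧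
        (sigNeg (LinearMap.BilinMap.toQuadraticMap H) : ℤ) = ind

end MorseBott

/-! ### Linkages -/

section Linkage

/-- The subset `I` of the index set is `ℓ`-short. -/
def IsShort {n : ℕ} (ℓ : Fin n → ℝ) (I : Finset (Fin n)) : Prop :=
  ∑ i ∈ I, ℓ i < ∑ i ∈ Iᶜ, ℓ i

/-- The subset `I` is `ℓ`-long: its complement is `ℓ`-short. -/
def IsLong {n : ℕ} (ℓ : Fin n → ℝ) (I : Finset (Fin n)) : Prop :=
  IsShort ℓ Iᶜ

/-- The first standard basis vector of `ℝ^d`. -/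
def e₁ (d : ℕ) [NeZero d] : EuclideanSpace ℝ (Fin d) :=
  EuclideanSpace.single 0 1

/-- The orthogonal transformations of `ℝ^d` that fix the first coordinate, a copy of `O(d-1)`. -/
def orthFix (d : ℕ) [NeZero d] :
    Subgroup (EuclideanSpace ℝ (Fin d) ≃ₗᵢ[ℝ] EuclideanSpace ℝ (Fin d)) where
  carrier := {A | A (e₁ d) = e₁ d}
  mul_mem' {A B} hA hB := by
    have hA' : A (e₁ d) = e₁ d := hA
    have hB' : B (e₁ d) = e₁ d := hB
    change A (B (e₁ d)) = e₁ d
    rw [hB', hA']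
  one_mem' := rfl
  inv_mem' {A} hA := by
    have hA' : A (e₁ d) = e₁ d := hA
    change A.symm (e₁ d) = e₁ d
    rw [LinearIsometryEquiv.symm_apply_eq, hA']

/-- The rotations of `ℝ^d` that fix the first coordinate, a copy of `SO(d-1)`. -/
def rotFix (d : ℕ) [NeZero d] :
    Subgroup (EuclideanSpace ℝ (Fin d) ≃ₗᵢ[ℝ] EuclideanSpace ℝ (Fin d)) where
  carrier := {A | A ∈ orthFix d ∧ LinearEquiv.det A.toLinearEquiv = 1}
  mul_mem' {A B} hA hB := by
    refine ⟨mul_mem hA.1 hB.1, ?_⟩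
    change LinearEquiv.det (A.toLinearEquiv * B.toLinearEquiv) = 1
    rw [map_mul, hA.2, hB.2, one_mul]
  one_mem' := ⟨one_mem _, map_one LinearEquiv.det⟩
  inv_mem' {A} hA := by
    refine ⟨inv_mem hA.1, ?_⟩
    change LinearEquiv.det (A.toLinearEquiv)⁻¹ = 1
    rw [map_inv, hA.2, inv_one]

variable {m : ℕ}

/- A length vector with `n = m + 2` entries is a function on `Fin (m + 2)`. The links of a chain
`(z_1, …, z_{n-1})` are indexed by `i : Fin (m + 1)`, with length `ℓ i.castSucc`. The last two
lengths `ℓ_{n-1}` and `ℓ_n` are `ℓ (Fin.last m).castSucc` and `ℓ (Fin.last (m + 1))`, and the first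
`n - 2` links are the `i.castSucc` with `i : Fin m`. -/

/-- The space of chains `C_d(ℓ)`. -/
def chainSpace (d : ℕ) [NeZero d] (ℓ : Fin (m + 2) → ℝ) :
    Set (Fin (m + 1) → EuclideanSpace ℝ (Fin d)) :=
  {z | (∀ i, ‖z i‖ = 1) ∧ ∑ i, ℓ i.castSucc • z i = -(ℓ (Fin.last (m + 1)) • e₁ d)}

/-- The function `F(z) = ℓ_{n-1} p_1(z_{n-1}) + ℓ_n`, given on all tuples of vectors. -/
def heightF (d : ℕ) [NeZero d] (ℓ : Fin (m + 2) → ℝ)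
    (z : Fin (m + 1) → EuclideanSpace ℝ (Fin d)) : ℝ :=
  ℓ (Fin.last m).castSucc * z (Fin.last m) 0 + ℓ (Fin.last (m + 1))

/-- The unit vector `x = (x_1, x_2, 0, …, 0)` has `x_1 > 0` and `x_2 < 0`, and `z` is a chain in
`C_d(ℓ)` with `z_j = x` for `j ∈ J` and `z_j = -x` for `j ∈ {1, …, n-2} - J`. -/
def IsAligned {d : ℕ} [NeZero d] (ℓ : Fin (m + 2) → ℝ) (J : Finset (Fin (m + 2)))
    (x : EuclideanSpace ℝ (Fin d)) (z : Fin (m + 1) → EuclideanSpace ℝ (Fin d)) : Prop :=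
  ‖x‖ = 1 ∧ 0 < x 0 ∧ x 1 < 0 ∧ (∀ j : Fin d, 2 ≤ (j : ℕ) → x j = 0) ∧
    z ∈ chainSpace d ℓ ∧
    (∀ i : Fin m, i.castSucc.castSucc ∈ J → z i.castSucc = x) ∧
    ∀ i : Fin m, i.castSucc.castSucc ∉ J → z i.castSucc = -x

/-- The orbit, under the diagonal action of a group `G` of isometries of `ℝ^d`, of the chain
`(±x, …, ±x, z_{n-1})` that belongs to `J`. For `G = SO(d-1)` this is the orbit sphere `S_J`. -/
def alignedOrbit {d : ℕ} [NeZero d]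
    (G : Subgroup (EuclideanSpace ℝ (Fin d) ≃ₗᵢ[ℝ] EuclideanSpace ℝ (Fin d)))
    (ℓ : Fin (m + 2) → ℝ) (J : Finset (Fin (m + 2))) :
    Set (Fin (m + 1) → EuclideanSpace ℝ (Fin d)) :=
  {w | ∃ x z, IsAligned ℓ J x z ∧ ∃ A ∈ G, w = fun i => A (z i)}

end Linkage

end

/-! Put b = ℓ_{n-1}, c = ℓ_n, let ε_i be 1 on J and -1 on the other indices up to n-2, and s = -∑
ε_i ℓ_i over these n-2 indices. In an aligned chain p the first n-2 links are ε_i u, and closure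
becomes s u = b p_{n-1} + c e, a triangle with sides s, b, c. The short and long conditions say c -
s < b and s < b + c. With b ≤ c they give s > 0 and a nondegenerate triangle, so the law of cosines
fixes the inner product κ of the last link with e, and κ² < 1. The last link determines the whole
chain, and `alignedSet` is a copy of a (d-2)-sphere.

The crux is `height_eq`: on the chain space F is exactly F(p) + B(z - p, z - p), where 2c B(v, w) =
s ∑ ε_i ℓ_i ⟨v_i, w_i⟩ + b² ⟨v_{n-1}, w_{n-1}⟩. Hence p is critical and the Hessian is 2B on the
tangent space, with no Lagrange multipliers or local coordinates.

The shifts (ε_i a, (s/b) a) satisfy the linearized closure equation and are B-orthogonal to all its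
solutions (`alignedForm_alignedShift`). The tangent shifts are the radical of B, which is the
tangent space of `alignedSet` (`alignedForm_radical`). For the index, moving the links with ε_i = -1
against one of them, i₀, gives a negative definite space of dimension (n-3-|J|)(d-1). Conversely, if
all these links move by the same vector, a shift brings them to rest, leaving only nonnegative
terms.

A reflection exchanging two last links shows that O(d-1) acts transitively on `alignedSet`. For d ≥
3 a reflection in the third coordinate corrects the determinant; for d = 2 the SO(1)-orbit is an
isolated point of `alignedSet`. -/

noncomputable section

/-! ### Regular level sets: charts and tangent vectors -/

section RegularLevelSet

variable {E G : Type*} [NormedAddCommGroup E] [NormedSpace ℝ E] [FiniteDimensional ℝ E]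
  [NormedAddCommGroup G] [NormedSpace ℝ G] [FiniteDimensional ℝ G]

/-- If `g` is a submersion at `p`, a local diffeomorphism straightens its zero set near `p`
to the kernel of its differential. -/
theorem exists_straightening {g : E → G} (hg : ContDiff ℝ ∞ g) {p : E} {A : E →L[ℝ] G}
    (hA : HasFDerivAt g A p) (hsurj : Function.Surjective A) {M : Set E}
    (hM : ∀ᶠ q in 𝓝 p, q ∈ M ↔ g q = 0) :
    ∃ Φ : OpenPartialHomeomorph E E, p ∈ Φ.source ∧ ContDiffOn ℝ ∞ Φ Φ.source ∧
      ContDiffOn ℝ ∞ Φ.symm Φ.target ∧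
      (∀ q ∈ Φ.source, q ∈ M ↔ Φ q ∈ LinearMap.ker A.toLinearMap) ∧
      HasFDerivAt Φ (ContinuousLinearEquiv.refl ℝ E : E →L[ℝ] E) p := by
  have : CompleteSpace E := FiniteDimensional.complete ℝ E
  obtain ⟨R₀, hR₀⟩ := A.toLinearMap.exists_rightInverse_of_surjective
    (LinearMap.range_eq_top.2 hsurj)
  let R : G →L[ℝ] E := LinearMap.toContinuousLinearMap R₀
  have hR : ∀ y, A (R y) = y := fun y => LinearMap.congr_fun hR₀ y
  -- Replacing the linear part R A z by R g(z) gives A ∘ Ψ = g, while the derivative at p stays the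
  -- identity.
  let Ψ : E → E := fun z => z - R (A z) + R (g z)
  have hΨ : ContDiff ℝ ∞ Ψ :=
    (contDiff_id.sub (R.contDiff.comp A.contDiff)).add (R.contDiff.comp hg)
  have hΨ' : HasFDerivAt Ψ (ContinuousLinearEquiv.refl ℝ E : E →L[ℝ] E) p := by
    have h := ((hasFDerivAt_id p).sub (R.hasFDerivAt.comp p A.hasFDerivAt)).add
      (R.hasFDerivAt.comp p hA)
    refine (h.congr_fderiv ?_)
    ext v
    simp
  have hn : (∞ : WithTop ℕ∞) ≠ 0 := by simp
  let Φ₀ := hΨ.contDiffAt.toOpenPartialHomeomorph Ψ hΨ' hn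
  -- The inverse must be smooth on the whole target, so the source is shrunk to points where the
  -- derivative of Ψ is invertible.
  let N : Set E := (fderiv ℝ Ψ) ⁻¹' range ((↑) : (E ≃L[ℝ] E) → E →L[ℝ] E)
  have hN : IsOpen N :=
    (ContinuousLinearEquiv.isOpen (𝕜 := ℝ) (E := E) (F := E)).preimage
      (hΨ.continuous_fderiv hn)
  obtain ⟨W, hWsub, hW, hpW⟩ := mem_nhds_iff.1 hM
  let Φ := Φ₀.restrOpen (N ∩ W) (hN.inter hW)
  have hsource : Φ.source = Φ₀.source ∩ (N ∩ W) := rfl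
  refine ⟨Φ, ?_, hΨ.contDiffOn, ?_, ?_, hΨ'⟩
  · exact ⟨hΨ.contDiffAt.mem_toOpenPartialHomeomorph_source hΨ' hn, ⟨_, hΨ'.fderiv.symm⟩, hpW⟩
  · intro y hy
    obtain ⟨B, hB⟩ := ((Φ.map_target hy).2).1
    refine (Φ.contDiffAt_symm (f₀' := B) hy ?_ hΨ.contDiffAt).contDiffWithinAt
    rw [hB]
    exact (hΨ.differentiable hn _).hasFDerivAt
  · intro q hq
    have h1 : A (Ψ q) = g q := by simp [Ψ, hR]
    change _ ↔ A (Ψ q) = 0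
    rw [h1]
    exact hWsub hq.2.2

theorem isSubmanifoldAt_of_surjective {g : E → G} (hg : ContDiff ℝ ∞ g) {p : E} {A : E →L[ℝ] G}
    (hA : HasFDerivAt g A p) (hsurj : Function.Surjective A) {M : Set E} (hp : p ∈ M)
    (hM : ∀ᶠ q in 𝓝 p, q ∈ M ↔ g q = 0) :
    IsSubmanifoldAt M ((Module.finrank ℝ E : ℤ) - Module.finrank ℝ G) p := by
  obtain ⟨Φ, h1, h2, h3, h4, -⟩ := exists_straightening hg hA hsurj hM
  refine ⟨hp, Φ, LinearMap.ker A.toLinearMap, h1, h2, h3, ?_, h4⟩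
  have h := A.toLinearMap.finrank_range_add_finrank_ker
  rw [LinearMap.range_eq_top.2 hsurj, finrank_top] at h
  omega

theorem tangentVectors_eq_ker {g : E → G} (hg : ContDiff ℝ ∞ g) {p : E} {A : E →L[ℝ] G}
    (hA : HasFDerivAt g A p) (hsurj : Function.Surjective A) {M : Set E} (hp : p ∈ M)
    (hM : ∀ᶠ q in 𝓝 p, q ∈ M ↔ g q = 0) :
    tangentVectors M p = {v | A v = 0} := by
  have : CompleteSpace E := FiniteDimensional.complete ℝ E
  ext v
  constructor
  · rintro ⟨γ, ⟨hγ, hγ0, hγM⟩, hv⟩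
    have hA' : HasFDerivAt g A (γ 0) := by rwa [hγ0]
    have h1 : HasDerivAt (g ∘ γ) (A v) 0 := hA'.comp_hasDerivAt 0 hv
    have hc : Tendsto γ (𝓝 0) (𝓝 p) := by simpa [hγ0] using hv.continuousAt.tendsto
    have h2 : (g ∘ γ) =ᶠ[𝓝 0] fun _ => (0 : G) := by
      filter_upwards [hγM, hc.eventually hM] with t ht1 ht2 using ht2.1 ht1
    exact h1.unique ((hasDerivAt_const (0 : ℝ) (0 : G)).congr_of_eventuallyEq h2)
  · intro hv
    obtain ⟨Φ, h1, h2, h3, h4, h5⟩ := exists_straightening hg hA hsurj hM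
    have hpt : Φ p ∈ Φ.target := Φ.map_source h1
    have hline : HasDerivAt (fun t : ℝ => Φ p + t • v) v 0 := by
      simpa using ((hasDerivAt_id (0 : ℝ)).smul_const v).const_add (Φ p)
    have h0 : Φ p + (0 : ℝ) • v = Φ p := by simp
    have hsymm : HasFDerivAt Φ.symm (ContinuousLinearEquiv.refl ℝ E : E →L[ℝ] E) (Φ p) := by
      have h5' : HasFDerivAt Φ (ContinuousLinearEquiv.refl ℝ E : E →L[ℝ] E) (Φ.symm (Φ p)) := by
        rwa [Φ.left_inv h1]
      exact Φ.hasFDerivAt_symm hpt h5'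
    -- A straight line in the kernel, pulled back by the chart; its velocity is v because the chart
    -- has identity derivative at p.
    refine ⟨fun t => Φ.symm (Φ p + t • v), ⟨?_, ?_, ?_⟩, ?_⟩
    · have : ContDiffAt ℝ ∞ Φ.symm (Φ p + (0 : ℝ) • v) := by
        rw [h0]
        exact h3.contDiffAt (Φ.open_target.mem_nhds hpt)
      exact this.comp (0 : ℝ) (contDiffAt_const.add (contDiffAt_id.smul contDiffAt_const))
    · simp [Φ.left_inv h1]
    · have hmem : ∀ᶠ t : ℝ in 𝓝 0, Φ p + t • v ∈ Φ.target :=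
        hline.continuousAt.eventually_mem (by
          simpa [h0] using Φ.open_target.mem_nhds hpt)
      filter_upwards [hmem] with t ht
      rw [h4 _ (Φ.map_target ht), Φ.right_inv ht]
      exact Submodule.add_mem _ ((h4 p h1).1 hp) (Submodule.smul_mem _ _ hv)
    · have := (h0.symm ▸ hsymm :
        HasFDerivAt Φ.symm (ContinuousLinearEquiv.refl ℝ E : E →L[ℝ] E) (Φ p + (0 : ℝ) • v))
      exact this.comp_hasDerivAt 0 hline

end RegularLevelSet

/-! ### Functions that are quadratic on a subset -/

section QuadraticGerm

variable {E : Type*} [NormedAddCommGroup E] [NormedSpace ℝ E]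

/-- A function that agrees on `M` with a quadratic form `B (z - p) (z - p)` up to a constant has
vanishing first derivative along curves through `p`, and second derivative `2 B (v, v)`. -/
theorem hasDerivAt_comp_curve {M : Set E} {f : E → ℝ} {p : E} (B : E →L[ℝ] E →L[ℝ] ℝ)
    (hsymm : ∀ v w, B v w = B w v) (hf : ∀ z ∈ M, f z = f p + B (z - p) (z - p))
    {γ : ℝ → E} (hγ : IsCurveThrough M p γ) {v : E} (hv : HasDerivAt γ v 0) :
    HasDerivAt (fun t => f (γ t)) 0 0 ∧
      HasDerivAt (deriv fun t => f (γ t)) (2 * B v v) 0 := by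
  obtain ⟨hsm, h0, hM⟩ := hγ
  have heq : (fun t => f (γ t)) =ᶠ[𝓝 0] fun t => f p + B (γ t - p) (γ t - p) := by
    filter_upwards [hM] with t ht using hf _ ht
  have hder : ∀ t, DifferentiableAt ℝ γ t →
      HasDerivAt (fun t => f p + B (γ t - p) (γ t - p)) (2 * B (γ t - p) (deriv γ t)) t := by
    intro t ht
    have h1 : HasDerivAt (fun t => γ t - p) (deriv γ t) t := ht.hasDerivAt.sub_const p
    have h2 := ((B.hasFDerivAt.comp_hasDerivAt t h1).clm_apply h1).const_add (f p)
    refine h2.congr_deriv ?_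
    simp only [Function.comp]
    rw [hsymm (deriv γ t)]
    ring
  have hdiff : ∀ᶠ t in 𝓝 (0 : ℝ), DifferentiableAt ℝ γ t := by
    have h1 : ContDiffAt ℝ 1 γ 0 := hsm.of_le (by norm_cast)
    filter_upwards [h1.eventually (by simp)] with t ht using ht.differentiableAt (by simp)
  have hderiv2 : DifferentiableAt ℝ (deriv γ) 0 := by
    have h2 : ContDiffAt ℝ 1 (deriv γ) 0 := by
      exact (hsm.fderiv_right (m := 1) (by norm_cast)).clm_apply contDiffAt_const
    exact h2.differentiableAt (by simp)
  constructor
  · have := (hder 0 hv.differentiableAt).congr_of_eventuallyEq heq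
    simpa [h0] using this
  · have heq' : (deriv fun t => f (γ t)) =ᶠ[𝓝 0] fun t => 2 * B (γ t - p) (deriv γ t) := by
      filter_upwards [heq.eventually_nhds, hdiff] with t ht1 ht2
      exact ((hder t ht2).congr_of_eventuallyEq ht1).deriv
    have h1 : HasDerivAt (fun t => γ t - p) v 0 := hv.sub_const p
    -- The acceleration of γ is paired with γ 0 - p = 0, so it does not contribute.
    have h2 := ((B.hasFDerivAt.comp_hasDerivAt 0 h1).clm_apply hderiv2.hasDerivAt).const_mul 2
    refine (h2.congr_of_eventuallyEq heq').congr_deriv ?_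
    simp [h0, hv.deriv]

end QuadraticGerm

/-! ### The index from a negative subspace and a complementary bound -/

section Index

/-- A quadratic form that is negative definite on an injective image of `X` and nonnegative
on the kernel of a linear map to `X` has negative index of inertia `dim X`. -/
theorem sigNeg_eq_finrank {T X : Type*} [AddCommGroup T] [Module ℝ T] [FiniteDimensional ℝ T]
    [AddCommGroup X] [Module ℝ X] [FiniteDimensional ℝ X] (Q : QuadraticForm ℝ T)
    (φ : T →ₗ[ℝ] X) (ι : X →ₗ[ℝ] T) (hφ : ∀ v, φ v = 0 → 0 ≤ Q v)
    (hι : ∀ x, x ≠ 0 → Q (ι x) < 0) : sigNeg Q = Module.finrank ℝ X := by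
  apply le_antisymm
  · obtain ⟨V, hV, hneg⟩ := exists_finrank_eq_sigNeg_and_negDef Q
    rw [← hV]
    apply LinearMap.finrank_le_finrank_of_injective (f := φ ∘ₗ V.subtype)
    rw [← LinearMap.ker_eq_bot, LinearMap.ker_eq_bot']
    intro v hv
    by_contra hne
    have h1 := hneg v hne
    have h2 := hφ v hv
    simp only [QuadraticMap.restrict_apply, neg_apply] at h1
    linarith
  · have hinj : Function.Injective ι := by
      rw [← LinearMap.ker_eq_bot, LinearMap.ker_eq_bot']
      intro x hx
      by_contra hne
      simpa [hx] using hι x hne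
    rw [← LinearMap.finrank_range_of_inj hinj]
    apply le_sigNeg_of_negDef
    rintro ⟨_, x, rfl⟩ hx
    have hx0 : x ≠ 0 := by
      rintro rfl
      simp at hx
    simpa using hι x hx0

end Index

/-! ### Aligned chains, their triangle, and the quadratic identity -/

section AlignedConfiguration

variable {V : Type*} [NormedAddCommGroup V] [InnerProductSpace ℝ V]

/-- Cramer's rule in the span of a and b: the Gram determinant is 1 - ⟨a, b⟩². -/
theorem exists_inner_eq_inner_eq {a b : V} (ha : ‖a‖ = 1) (hb : ‖b‖ = 1)
    (hab : inner ℝ a b ^ 2 < 1) (α β : ℝ) : ∃ v : V, inner ℝ a v = α ∧ inner ℝ b v = β := by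
  have hne : 1 - inner ℝ a b ^ 2 ≠ 0 := by linarith
  have ha' : inner ℝ a a = 1 := by rw [real_inner_self_eq_norm_sq, ha, one_pow]
  have hb' : inner ℝ b b = 1 := by rw [real_inner_self_eq_norm_sq, hb, one_pow]
  have hba : inner ℝ b a = inner ℝ a b := real_inner_comm _ _
  refine ⟨((α - inner ℝ a b * β) / (1 - inner ℝ a b ^ 2)) • a +
    ((β - inner ℝ a b * α) / (1 - inner ℝ a b ^ 2)) • b, ?_, ?_⟩ <;>
  · simp only [inner_add_right, inner_smul_right, ha', hb', hba]
    field_simp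
    ring

variable {m : ℕ}

/-- Chains of unit vectors with lengths `L` in a general inner product space, with end point
`-c • e`. -/
def chainSet (L : Fin (m + 1) → ℝ) (c : ℝ) (e : V) : Set (Fin (m + 1) → V) :=
  {z | (∀ i, ‖z i‖ = 1) ∧ ∑ i, L i • z i = -(c • e)}

/-- All the links of the chain `p` but the last one are `± u`, with signs `ε`. -/
structure IsAlignedAt (L : Fin (m + 1) → ℝ) (c s : ℝ) (ε : Fin m → ℝ) (e u : V)
    (p : Fin (m + 1) → V) : Prop where
  L_pos : ∀ i, 0 < L i
  c_pos : 0 < c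
  s_pos : 0 < s
  eps : ∀ i, ε i = 1 ∨ ε i = -1
  sum_eps : ∑ i : Fin m, ε i * L i.castSucc = -s
  e_norm : ‖e‖ = 1
  u_norm : ‖u‖ = 1
  indep : inner ℝ e u ^ 2 < 1
  mem : p ∈ chainSet L c e
  castSucc : ∀ i : Fin m, p i.castSucc = ε i • u

/-- The symmetric bilinear form that governs the height function near an aligned chain. -/
def alignedForm (V : Type*) [NormedAddCommGroup V] [InnerProductSpace ℝ V] (L : Fin (m + 1) → ℝ) (c s : ℝ) (ε : Fin m → ℝ) :
    (Fin (m + 1) → V) →L[ℝ] (Fin (m + 1) → V) →L[ℝ] ℝ :=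
  (2 * c)⁻¹ • (s • ∑ i : Fin m, (ε i * L i.castSucc) •
    (innerSL ℝ (E := V)).bilinearComp (ContinuousLinearMap.proj i.castSucc)
      (ContinuousLinearMap.proj i.castSucc) +
    L (Fin.last m) ^ 2 • (innerSL ℝ (E := V)).bilinearComp
      (ContinuousLinearMap.proj (Fin.last m)) (ContinuousLinearMap.proj (Fin.last m)))

theorem alignedForm_apply (L : Fin (m + 1) → ℝ) (c s : ℝ) (ε : Fin m → ℝ)
    (v w : Fin (m + 1) → V) : alignedForm V L c s ε v w =
      (2 * c)⁻¹ * (s * ∑ i : Fin m, ε i * L i.castSucc * inner ℝ (v i.castSucc) (w i.castSucc) +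
        L (Fin.last m) ^ 2 * inner ℝ (v (Fin.last m)) (w (Fin.last m))) := by
  simp [alignedForm, sum_apply, mul_add]

theorem alignedForm_symm (L : Fin (m + 1) → ℝ) (c s : ℝ) (ε : Fin m → ℝ)
    (v w : Fin (m + 1) → V) : alignedForm V L c s ε v w = alignedForm V L c s ε w v := by
  simp only [alignedForm_apply]
  simp only [real_inner_comm]

/-- The deformation `(ε i • a, (s / L_last) • a)` of an aligned chain. -/
def alignedShift (L : Fin (m + 1) → ℝ) (s : ℝ) (ε : Fin m → ℝ) (a : V) : Fin (m + 1) → V :=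
  Fin.snoc (α := fun _ => V) (fun i => ε i • a) ((s / L (Fin.last m)) • a)

@[simp] theorem alignedShift_castSucc (L : Fin (m + 1) → ℝ) (s : ℝ) (ε : Fin m → ℝ) (a : V)
    (i : Fin m) : alignedShift L s ε a i.castSucc = ε i • a := by
  simp [alignedShift]

@[simp] theorem alignedShift_last (L : Fin (m + 1) → ℝ) (s : ℝ) (ε : Fin m → ℝ) (a : V) :
    alignedShift L s ε a (Fin.last m) = (s / L (Fin.last m)) • a := by
  simp [alignedShift]

/-- The differential at `p` of the equations of the chain space. -/
def chainDifferential (L : Fin (m + 1) → ℝ) (p : Fin (m + 1) → V) :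
    (Fin (m + 1) → V) →L[ℝ] (Fin (m + 1) → ℝ) × V :=
  (ContinuousLinearMap.pi fun i => (2 : ℝ) • (innerSL ℝ (p i)).comp
    (ContinuousLinearMap.proj (φ := fun _ => V) i)).prod
    (∑ i, L i • ContinuousLinearMap.proj (φ := fun _ => V) i)

theorem chainDifferential_apply (L : Fin (m + 1) → ℝ) (p v : Fin (m + 1) → V) :
    chainDifferential L p v = (fun i => 2 * inner ℝ (p i) (v i), ∑ i, L i • v i) := by
  ext <;> simp [chainDifferential]

theorem mem_ker_chainDifferential {L : Fin (m + 1) → ℝ} {p v : Fin (m + 1) → V} :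
    v ∈ LinearMap.ker (chainDifferential L p).toLinearMap ↔
      (∀ i, inner ℝ (p i) (v i) = 0) ∧ ∑ i, L i • v i = 0 := by
  simp [chainDifferential_apply, funext_iff]

/-- The equations of the chain space. -/
def chainEquation (L : Fin (m + 1) → ℝ) (c : ℝ) (e : V) (z : Fin (m + 1) → V) :
    (Fin (m + 1) → ℝ) × V :=
  (fun i => inner ℝ (z i) (z i) - 1, ∑ i, L i • z i + c • e)

theorem mem_chainSet_iff {L : Fin (m + 1) → ℝ} {c : ℝ} {e : V} {z : Fin (m + 1) → V} :
    z ∈ chainSet L c e ↔ chainEquation L c e z = 0 := by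
  simp only [chainSet, mem_ofPred_eq, chainEquation, Prod.ext_iff, Prod.fst_zero, Prod.snd_zero,
    funext_iff, Pi.zero_apply, real_inner_self_eq_norm_sq, eq_neg_iff_add_eq_zero]
  refine and_congr (forall_congr' fun i => ?_) Iff.rfl
  rw [sub_eq_zero, pow_eq_one_iff_of_nonneg (norm_nonneg _) two_ne_zero]

theorem contDiff_chainEquation (L : Fin (m + 1) → ℝ) (c : ℝ) (e : V) :
    ContDiff ℝ ∞ (chainEquation L c e) := by
  have hproj : ∀ i, ContDiff ℝ ∞ fun z : Fin (m + 1) → V => z i := fun i => contDiff_apply ℝ V i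
  exact (contDiff_pi.2 fun i => ((hproj i).inner ℝ (hproj i)).sub contDiff_const).prodMk
    ((ContDiff.sum fun i _ => contDiff_const.smul (hproj i)).add contDiff_const)

theorem hasFDerivAt_chainEquation (L : Fin (m + 1) → ℝ) (c : ℝ) (e : V)
    (p : Fin (m + 1) → V) :
    HasFDerivAt (chainEquation L c e) (chainDifferential L p) p := by
  have hproj : ∀ i, HasFDerivAt (fun z : Fin (m + 1) → V => z i)
      (ContinuousLinearMap.proj (R := ℝ) (φ := fun _ => V) i) p := fun i => hasFDerivAt_apply i p
  refine HasFDerivAt.prodMk ?_ ?_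
  · rw [hasFDerivAt_pi]
    intro i
    refine (((hproj i).inner ℝ (hproj i)).sub_const 1).congr_fderiv ?_
    ext v
    simp [real_inner_comm, two_mul]
  · exact (HasFDerivAt.fun_sum fun i _ => (hproj i).const_smul (L i)).add_const _

theorem sum_smul_castSucc {L : Fin (m + 1) → ℝ} {v : Fin (m + 1) → V} {a : V}
    (h : ∑ i, L i • v i = a) :
    ∑ i : Fin m, L i.castSucc • v i.castSucc = a - L (Fin.last m) • v (Fin.last m) := by
  rw [← h, Fin.sum_univ_castSucc, add_sub_cancel_right]

namespace IsAlignedAt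

variable {L : Fin (m + 1) → ℝ} {c s : ℝ} {ε : Fin m → ℝ} {e u : V} {p : Fin (m + 1) → V}

theorem eps_mul_self (h : IsAlignedAt L c s ε e u p) (i : Fin m) : ε i * ε i = 1 := by
  rcases h.eps i with h | h <;> rw [h] <;> norm_num

/-- The closing triangle. Pairing this relation with u, e and itself yields the identities below,
including the law of cosines. -/
theorem last_smul (h : IsAlignedAt L c s ε e u p) :
    L (Fin.last m) • p (Fin.last m) = s • u - c • e := by
  have h1 := h.mem.2
  rw [Fin.sum_univ_castSucc] at h1
  simp only [h.castSucc, smul_smul, ← Finset.sum_smul, mul_comm (L _) (ε _), h.sum_eps] at h1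
  rw [← eq_sub_iff_add_eq'] at h1
  rw [h1]
  module

theorem inner_e_e (h : IsAlignedAt L c s ε e u p) : inner ℝ e e = 1 := by
  rw [real_inner_self_eq_norm_sq, h.e_norm, one_pow]

theorem inner_u_u (h : IsAlignedAt L c s ε e u p) : inner ℝ u u = 1 := by
  rw [real_inner_self_eq_norm_sq, h.u_norm, one_pow]

theorem inner_p_p (h : IsAlignedAt L c s ε e u p) (i) : inner ℝ (p i) (p i) = 1 := by
  rw [real_inner_self_eq_norm_sq, h.mem.1, one_pow]

theorem inner_last_u (h : IsAlignedAt L c s ε e u p) :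
    L (Fin.last m) * inner ℝ (p (Fin.last m)) u = s - c * inner ℝ e u := by
  have h1 := congrArg (fun x => inner ℝ x u) h.last_smul
  simp only [inner_sub_left, real_inner_smul_left, h.inner_u_u] at h1
  linarith

theorem inner_last_e (h : IsAlignedAt L c s ε e u p) :
    L (Fin.last m) * inner ℝ (p (Fin.last m)) e = s * inner ℝ e u - c := by
  have h1 := congrArg (fun x => inner ℝ x e) h.last_smul
  simp only [inner_sub_left, real_inner_smul_left, h.inner_e_e, real_inner_comm e u] at h1
  linarith

theorem last_sq (h : IsAlignedAt L c s ε e u p) :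
    L (Fin.last m) ^ 2 = s ^ 2 + c ^ 2 - 2 * s * c * inner ℝ e u := by
  have h1 := congrArg (fun x => inner ℝ x x) h.last_smul
  simp only [inner_sub_left, inner_sub_right, real_inner_smul_left, real_inner_smul_right,
    h.inner_u_u, h.inner_e_e, h.inner_p_p, real_inner_comm e u] at h1
  linarith

/-- The law of sines transfers nondegeneracy from the angle between e and u to the other angles of
the triangle. -/
theorem indep_u_last (h : IsAlignedAt L c s ε e u p) :
    inner ℝ u (p (Fin.last m)) ^ 2 < 1 := by
  have h1 := h.inner_last_u
  have h2 := h.last_sq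
  have h3 : 0 < c ^ 2 * (1 - inner ℝ e u ^ 2) :=
    mul_pos (pow_pos h.c_pos 2) (by linarith [h.indep])
  have h4 : L (Fin.last m) ^ 2 * (1 - inner ℝ (p (Fin.last m)) u ^ 2)
      = c ^ 2 * (1 - inner ℝ e u ^ 2) := by
    have : L (Fin.last m) ^ 2 * (1 - inner ℝ (p (Fin.last m)) u ^ 2) =
      L (Fin.last m) ^ 2 - (L (Fin.last m) * inner ℝ (p (Fin.last m)) u) ^ 2 := by ring
    rw [this, h1, h2]
    ring
  rw [← h4] at h3
  rw [real_inner_comm]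
  linarith [pos_of_mul_pos_right h3 (sq_nonneg _)]

theorem indep_last_e (h : IsAlignedAt L c s ε e u p) :
    inner ℝ (p (Fin.last m)) e ^ 2 < 1 := by
  have h1 := h.inner_last_e
  have h2 := h.last_sq
  have h3 : 0 < s ^ 2 * (1 - inner ℝ e u ^ 2) :=
    mul_pos (pow_pos h.s_pos 2) (by linarith [h.indep])
  have h4 : L (Fin.last m) ^ 2 * (1 - inner ℝ (p (Fin.last m)) e ^ 2)
      = s ^ 2 * (1 - inner ℝ e u ^ 2) := by
    have : L (Fin.last m) ^ 2 * (1 - inner ℝ (p (Fin.last m)) e ^ 2) =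
      L (Fin.last m) ^ 2 - (L (Fin.last m) * inner ℝ (p (Fin.last m)) e) ^ 2 := by ring
    rw [this, h1, h2]
    ring
  rw [← h4] at h3
  linarith [pos_of_mul_pos_right h3 (sq_nonneg _)]

theorem exists_eps_neg (h : IsAlignedAt L c s ε e u p) : ∃ i, ε i = -1 := by
  by_contra! hne
  have h1 : 0 ≤ ∑ i : Fin m, ε i * L i.castSucc := Finset.sum_nonneg fun i _ => by
    rw [(h.eps i).resolve_right (hne i), one_mul]
    exact (h.L_pos _).le
  rw [h.sum_eps] at h1
  linarith [h.s_pos]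

/-- Radial motions solve the norm equations. The remaining closure error splits into a vector
orthogonal to the last link and one orthogonal to u, since these directions are independent; the
last link and one other link absorb the two parts. -/
theorem surjective_chainDifferential (h : IsAlignedAt L c s ε e u p) :
    Function.Surjective (chainDifferential L p) := by
  rintro ⟨α, β⟩
  obtain ⟨i₀, hi₀⟩ := h.exists_eps_neg
  set β' := β - ∑ i, L i • (α i / 2) • p i with hβ'
  -- The vector a has the same u-component as β' and is orthogonal to the last link, so β' - a is
  -- orthogonal to u.
  obtain ⟨a, ha1, ha2⟩ := exists_inner_eq_inner_eq h.u_norm (h.mem.1 (Fin.last m))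
    h.indep_u_last (inner ℝ u β') 0
  have hb := (h.L_pos (Fin.last m)).ne'
  have hl := (h.L_pos i₀.castSucc).ne'
  have hne : i₀.castSucc ≠ Fin.last m := (Fin.castSucc_lt_last i₀).ne
  have hsingle : ∀ j x, inner ℝ (p j) x = 0 →
      ∀ i, inner ℝ (p i) (Pi.single (M := fun _ => V) j x i) = 0 := by
    intro j x hx i
    by_cases hij : i = j
    · subst hij; simpa using hx
    · simp [Pi.single_eq_of_ne hij]
  have hs1 := hsingle (Fin.last m) ((L (Fin.last m))⁻¹ • a) (by simp [inner_smul_right, ha2])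
  have hs2 := hsingle i₀.castSucc ((L i₀.castSucc)⁻¹ • (β' - a))
    (by simp [h.castSucc, inner_smul_right, inner_smul_left, inner_sub_right, ha1])
  have hsum : ∀ j x, ∑ i, L i • Pi.single (M := fun _ => V) j x i = L j • x := by
    intro j x
    rw [Finset.sum_eq_single j]
    · simp
    · intro i _ hij
      simp [Pi.single_eq_of_ne hij]
    · simp
  refine ⟨fun i => (α i / 2) • p i +
    (Pi.single (M := fun _ => V) (Fin.last m) ((L (Fin.last m))⁻¹ • a) i +
    Pi.single (M := fun _ => V) i₀.castSucc ((L i₀.castSucc)⁻¹ • (β' - a)) i), ?_⟩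
  rw [chainDifferential_apply]
  refine Prod.ext (funext fun i => ?_) ?_
  · simp only [inner_add_right, hs1, hs2, inner_smul_right, h.inner_p_p]
    ring
  · simp only [smul_add, Finset.sum_add_distrib, hsum, smul_inv_smul₀ hb, smul_inv_smul₀ hl, hβ']
    abel

/-- On the chain space the height function is a quadratic form centred at an aligned chain. -/
theorem height_eq (h : IsAlignedAt L c s ε e u p) {z : Fin (m + 1) → V}
    (hz : z ∈ chainSet L c e) :
    L (Fin.last m) * inner ℝ (z (Fin.last m)) e + c =
      L (Fin.last m) * inner ℝ (p (Fin.last m)) e + c + alignedForm V L c s ε (z - p) (z - p) := by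
  have hsq : ∀ i, inner ℝ ((z - p) i) ((z - p) i) = 2 - 2 * inner ℝ (z i) (p i) := by
    intro i
    have h1 : inner ℝ (z i) (z i) = 1 := by rw [real_inner_self_eq_norm_sq, hz.1, one_pow]
    simp only [Pi.sub_apply, inner_sub_left, inner_sub_right, h1, h.inner_p_p,
      real_inner_comm (z i) (p i)]
    ring
  have h1 := congrArg (fun x => inner ℝ x u) (sum_smul_castSucc hz.2)
  simp only [sum_inner, inner_sub_left, inner_neg_left, real_inner_smul_left] at h1
  -- Since p_i = ε_i u and ε_i² = 1, the signs cancel in the inner products; the closure equation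
  -- then evaluates the sum through the last link.
  have h2 : ∑ i : Fin m, ε i * L i.castSucc *
      inner ℝ ((z - p) i.castSucc) ((z - p) i.castSucc) =
      -2 * s - 2 * ∑ i : Fin m, L i.castSucc * inner ℝ (z i.castSucc) u := by
    rw [mul_comm (-2) s, mul_neg, ← neg_mul, ← h.sum_eps, Finset.mul_sum, Finset.sum_mul,
      ← Finset.sum_sub_distrib]
    refine Finset.sum_congr rfl fun i _ => ?_
    rw [hsq, h.castSucc, inner_smul_right]
    linear_combination (-2 * L i.castSucc * inner ℝ (z i.castSucc) u) * h.eps_mul_self i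
  have h3 := congrArg (fun x => inner ℝ (z (Fin.last m)) x) h.last_smul
  simp only [inner_sub_right, inner_smul_right] at h3
  have h4 := h.inner_last_e
  have h5 := h.last_sq
  have hc := h.c_pos.ne'
  -- The coefficients s and b² are chosen so that the terms in ⟨z_last, u⟩ cancel through b p_last =
  -- s u - c e, leaving only ⟨z_last, e⟩.
  have h6 : s * (-2 * s - 2 * (-(c * inner ℝ e u) -
      L (Fin.last m) * inner ℝ (z (Fin.last m)) u)) +
      L (Fin.last m) ^ 2 * (2 - 2 * inner ℝ (z (Fin.last m)) (p (Fin.last m))) =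
      2 * c * (L (Fin.last m) * inner ℝ (z (Fin.last m)) e -
        L (Fin.last m) * inner ℝ (p (Fin.last m)) e) := by
    linear_combination (-2 * L (Fin.last m)) * h3 + 2 * c * h4 + 2 * h5
  rw [alignedForm_apply, h2, h1, hsq, h6, inv_mul_cancel_left₀ (by positivity)]
  ring

theorem sum_alignedShift (h : IsAlignedAt L c s ε e u p) (a : V) :
    ∑ i, L i • alignedShift L s ε a i = 0 := by
  have hb := (h.L_pos (Fin.last m)).ne'
  rw [Fin.sum_univ_castSucc]
  simp only [alignedShift_castSucc, alignedShift_last, smul_smul, ← Finset.sum_smul,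
    mul_comm (L _) (ε _), h.sum_eps]
  rw [mul_div_cancel₀ _ hb]
  module

/-- The signs and the factor s / b make the pairing proportional to ⟨a, ∑ L_i w_i⟩. Neither vector
has to be tangent to the spheres; only closure of w matters. -/
theorem alignedForm_alignedShift (h : IsAlignedAt L c s ε e u p) (a : V)
    {w : Fin (m + 1) → V} (hw : ∑ i, L i • w i = 0) :
    alignedForm V L c s ε (alignedShift L s ε a) w = 0 := by
  have hb := (h.L_pos (Fin.last m)).ne'
  have h1 := congrArg (fun x => inner ℝ a x) hw
  rw [Fin.sum_univ_castSucc] at h1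
  simp only [inner_add_right, inner_sum, inner_smul_right, inner_zero_right] at h1
  have h2 : ∀ i : Fin m, ε i * L i.castSucc *
      inner ℝ (alignedShift L s ε a i.castSucc) (w i.castSucc) =
      L i.castSucc * inner ℝ a (w i.castSucc) := by
    intro i
    rw [alignedShift_castSucc, real_inner_smul_left]
    linear_combination (L i.castSucc * inner ℝ a (w i.castSucc)) * h.eps_mul_self i
  rw [alignedForm_apply]
  simp only [h2, alignedShift_last, real_inner_smul_left]
  rw [mul_eq_zero]
  right
  field_simp
  linear_combination s * h1

theorem inner_u_castSucc (h : IsAlignedAt L c s ε e u p) {v : Fin (m + 1) → V}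
    (hv : ∀ i, inner ℝ (p i) (v i) = 0) (i : Fin m) : inner ℝ u (v i.castSucc) = 0 := by
  have h1 := hv i.castSucc
  rw [h.castSucc, real_inner_smul_left] at h1
  have h2 := h.eps_mul_self i
  rcases mul_eq_zero.1 h1 with h3 | h3
  · rw [h3] at h2; norm_num at h2
  · exact h3

theorem inner_u_last (h : IsAlignedAt L c s ε e u p) {v : Fin (m + 1) → V}
    (hv : ∀ i, inner ℝ (p i) (v i) = 0) (hsum : ∑ i, L i • v i = 0) :
    inner ℝ u (v (Fin.last m)) = 0 := by
  have h1 := congrArg (fun x => inner ℝ u x) hsum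
  rw [Fin.sum_univ_castSucc] at h1
  simp only [inner_add_right, inner_sum, inner_smul_right, inner_zero_right,
    h.inner_u_castSucc hv, mul_zero, Finset.sum_const_zero, zero_add] at h1
  exact (mul_eq_zero.1 h1).resolve_left (h.L_pos _).ne'

/-- The closing triangle puts e in the span of u and the last link. -/
theorem inner_e_of_inner_u (h : IsAlignedAt L c s ε e u p) {a : V} (hu : inner ℝ u a = 0)
    (hy : inner ℝ (p (Fin.last m)) a = 0) : inner ℝ e a = 0 := by
  have h1 := congrArg (fun x => inner ℝ x a) h.last_smul
  simp only [inner_sub_left, real_inner_smul_left, hu, hy] at h1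
  have h2 : c * inner ℝ e a = 0 := by linarith
  exact (mul_eq_zero.1 h2).resolve_left h.c_pos.ne'

end IsAlignedAt

end AlignedConfiguration

/-! ### The critical manifold and the radical of the Hessian -/

section AlignedHessian

variable {V : Type*} [NormedAddCommGroup V] [InnerProductSpace ℝ V] {m : ℕ}

/-- The chains whose links but the last are `± u`, where the last link makes an angle of cosine
`κ` with `e`. -/
def alignedSet (L : Fin (m + 1) → ℝ) (c s : ℝ) (ε : Fin m → ℝ) (e : V) (κ : ℝ) :
    Set (Fin (m + 1) → V) :=
  {w | (∀ i : Fin m, w i.castSucc = (ε i / s) • (L (Fin.last m) • w (Fin.last m) + c • e)) ∧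
    ‖w (Fin.last m)‖ = 1 ∧ inner ℝ (w (Fin.last m)) e = κ}

/-- The equations of the set of aligned chains. -/
def alignedEquation (L : Fin (m + 1) → ℝ) (c s : ℝ) (ε : Fin m → ℝ) (e : V) (κ : ℝ)
    (w : Fin (m + 1) → V) : (Fin m → V) × ℝ × ℝ :=
  (fun i => w i.castSucc - (ε i / s) • (L (Fin.last m) • w (Fin.last m) + c • e),
    inner ℝ (w (Fin.last m)) (w (Fin.last m)) - 1, inner ℝ (w (Fin.last m)) e - κ)

theorem mem_alignedSet_iff {L : Fin (m + 1) → ℝ} {c s : ℝ} {ε : Fin m → ℝ} {e : V} {κ : ℝ}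
    {w : Fin (m + 1) → V} :
    w ∈ alignedSet L c s ε e κ ↔ alignedEquation L c s ε e κ w = 0 := by
  simp only [alignedSet, mem_ofPred_eq, alignedEquation, Prod.ext_iff, Prod.fst_zero,
    Prod.snd_zero, funext_iff, Pi.zero_apply, real_inner_self_eq_norm_sq, sub_eq_zero,
    pow_eq_one_iff_of_nonneg (norm_nonneg _) two_ne_zero]

theorem contDiff_alignedEquation (L : Fin (m + 1) → ℝ) (c s : ℝ) (ε : Fin m → ℝ) (e : V)
    (κ : ℝ) : ContDiff ℝ ∞ (alignedEquation L c s ε e κ) := by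
  have hproj : ∀ i, ContDiff ℝ ∞ fun z : Fin (m + 1) → V => z i := fun i => contDiff_apply ℝ V i
  exact (contDiff_pi.2 fun i => (hproj _).sub
      (contDiff_const.smul ((contDiff_const.smul (hproj _)).add contDiff_const))).prodMk
    ((((hproj _).inner ℝ (hproj _)).sub contDiff_const).prodMk
      (((hproj _).inner ℝ contDiff_const).sub contDiff_const))

theorem isClosed_alignedSet (L : Fin (m + 1) → ℝ) (c s : ℝ) (ε : Fin m → ℝ) (e : V) (κ : ℝ) :
    IsClosed (alignedSet L c s ε e κ) := by
  have : alignedSet L c s ε e κ = alignedEquation L c s ε e κ ⁻¹' {0} := by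
    ext w
    exact mem_alignedSet_iff
  rw [this]
  exact isClosed_singleton.preimage (contDiff_alignedEquation L c s ε e κ).continuous

/-- The differential at `p` of the equations of the set of aligned chains. -/
def alignedDifferential (L : Fin (m + 1) → ℝ) (s : ℝ) (ε : Fin m → ℝ) (e : V)
    (p : Fin (m + 1) → V) : (Fin (m + 1) → V) →L[ℝ] (Fin m → V) × ℝ × ℝ :=
  (ContinuousLinearMap.pi fun i => ContinuousLinearMap.proj (φ := fun _ => V) i.castSucc -
    (ε i / s) • L (Fin.last m) • ContinuousLinearMap.proj (φ := fun _ => V) (Fin.last m)).prod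
  (((2 : ℝ) • (innerSL ℝ (p (Fin.last m))).comp
    (ContinuousLinearMap.proj (φ := fun _ => V) (Fin.last m))).prod
    ((innerSL ℝ e).comp (ContinuousLinearMap.proj (φ := fun _ => V) (Fin.last m))))

theorem alignedDifferential_apply (L : Fin (m + 1) → ℝ) (s : ℝ) (ε : Fin m → ℝ) (e : V)
    (p v : Fin (m + 1) → V) : alignedDifferential L s ε e p v =
      (fun i => v i.castSucc - (ε i / s) • L (Fin.last m) • v (Fin.last m),
        2 * inner ℝ (p (Fin.last m)) (v (Fin.last m)), inner ℝ e (v (Fin.last m))) := by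
  rfl

theorem hasFDerivAt_alignedEquation (L : Fin (m + 1) → ℝ) (c s : ℝ) (ε : Fin m → ℝ) (e : V)
    (κ : ℝ) (p : Fin (m + 1) → V) :
    HasFDerivAt (alignedEquation L c s ε e κ) (alignedDifferential L s ε e p) p := by
  have hproj : ∀ i, HasFDerivAt (fun z : Fin (m + 1) → V => z i)
      (ContinuousLinearMap.proj (R := ℝ) (φ := fun _ => V) i) p := fun i => hasFDerivAt_apply i p
  refine HasFDerivAt.prodMk ?_ (HasFDerivAt.prodMk ?_ ?_)
  · rw [hasFDerivAt_pi]
    intro i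
    exact (hproj _).sub ((((hproj _).const_smul _).add_const _).const_smul _)
  · refine (((hproj _).inner ℝ (hproj _)).sub_const 1).congr_fderiv ?_
    ext v
    simp [real_inner_comm, two_mul]
  · refine (((hproj _).inner ℝ (hasFDerivAt_const e p)).sub_const κ).congr_fderiv ?_
    ext v
    simp [real_inner_comm]

/-- The direction `u` of the aligned links is recovered from the last link. -/
theorem isAlignedAt_of_mem_alignedSet {L : Fin (m + 1) → ℝ} {c s : ℝ} {ε : Fin m → ℝ} {e : V}
    {κ : ℝ} (hL : ∀ i, 0 < L i) (hc : 0 < c) (hs : 0 < s) (hε : ∀ i, ε i = 1 ∨ ε i = -1)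
    (hsum : ∑ i : Fin m, ε i * L i.castSucc = -s) (he : ‖e‖ = 1)
    (hκs : s ^ 2 = L (Fin.last m) ^ 2 + c ^ 2 + 2 * L (Fin.last m) * c * κ) (hκ : κ ^ 2 < 1)
    {p : Fin (m + 1) → V} (hp : p ∈ alignedSet L c s ε e κ) :
    IsAlignedAt L c s ε e (s⁻¹ • (L (Fin.last m) • p (Fin.last m) + c • e)) p := by
  obtain ⟨h1, h2, h3⟩ := hp
  have hee : inner ℝ e e = 1 := by rw [real_inner_self_eq_norm_sq, he, one_pow]
  have hyy : inner ℝ (p (Fin.last m)) (p (Fin.last m)) = 1 := by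
    rw [real_inner_self_eq_norm_sq, h2, one_pow]
  have hsn := hs.ne'
  have hu : ‖s⁻¹ • (L (Fin.last m) • p (Fin.last m) + c • e)‖ = 1 := by
    rw [← pow_eq_one_iff_of_nonneg (norm_nonneg _) two_ne_zero, ← real_inner_self_eq_norm_sq]
    simp only [inner_add_left, inner_add_right, real_inner_smul_left, real_inner_smul_right, hee,
      hyy, h3, real_inner_comm (p (Fin.last m)) e]
    field_simp
    linear_combination -hκs
  have hcast : ∀ i : Fin m, p i.castSucc =
      ε i • s⁻¹ • (L (Fin.last m) • p (Fin.last m) + c • e) := by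
    intro i
    rw [h1, smul_smul, div_eq_mul_inv]
  refine ⟨hL, hc, hs, hε, hsum, he, hu, ?_, ⟨?_, ?_⟩, hcast⟩
  -- With this cosine, the law of cosines gives s² (1 - ⟨e, u⟩²) = b² (1 - κ²) > 0.
  · have h4 : inner ℝ e (s⁻¹ • (L (Fin.last m) • p (Fin.last m) + c • e)) =
        (L (Fin.last m) * κ + c) / s := by
      simp only [inner_add_right, real_inner_smul_right, hee, real_inner_comm (p (Fin.last m)) e,
        h3]
      field_simp
    rw [h4, div_pow, div_lt_one (by positivity), hκs]
    have := mul_pos (pow_pos (hL (Fin.last m)) 2) (sub_pos.2 hκ)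
    linarith
  · intro i
    induction i using Fin.lastCases with
    | last => exact h2
    | cast i =>
      rw [hcast, norm_smul, hu]
      rcases hε i with h | h <;> simp [h]
  · rw [Fin.sum_univ_castSucc]
    simp only [hcast, smul_smul, ← Finset.sum_smul, mul_comm (L _) (ε _ * _)]
    simp only [mul_right_comm _ _ (L _), ← Finset.sum_mul, hsum]
    rw [neg_mul, mul_inv_cancel₀ hsn]
    module

namespace IsAlignedAt

variable {L : Fin (m + 1) → ℝ} {c s : ℝ} {ε : Fin m → ℝ} {e u : V} {p : Fin (m + 1) → V}

/-- The equations are triangular: the last link solves the two scalar ones, being independent of e,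
and the other links are then free. -/
theorem surjective_alignedDifferential (h : IsAlignedAt L c s ε e u p) :
    Function.Surjective (alignedDifferential L s ε e p) := by
  rintro ⟨β, α₁, α₂⟩
  obtain ⟨v, hv1, hv2⟩ := exists_inner_eq_inner_eq (h.mem.1 (Fin.last m)) h.e_norm
    h.indep_last_e (α₁ / 2) α₂
  refine ⟨Fin.snoc (α := fun _ => V) (fun i => β i + (ε i / s) • L (Fin.last m) • v) v, ?_⟩
  rw [alignedDifferential_apply]
  simp [hv1, hv2, mul_div_cancel₀]

/-- The radical of the form that governs the height function is the tangent space of the set of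
aligned chains. -/
theorem alignedForm_radical (h : IsAlignedAt L c s ε e u p) {v : Fin (m + 1) → V}
    (hv : v ∈ LinearMap.ker (chainDifferential L p).toLinearMap) :
    (∀ w ∈ LinearMap.ker (chainDifferential L p).toLinearMap, alignedForm V L c s ε v w = 0) ↔
      alignedDifferential L s ε e p v = 0 := by
  have hb := (h.L_pos (Fin.last m)).ne'
  have hs := h.s_pos.ne'
  obtain ⟨hv1, hv2⟩ := mem_ker_chainDifferential.1 hv
  -- The only shift with the same last component as v; the claim is that v lies in the radical
  -- exactly when it equals this shift.
  set a := (L (Fin.last m) / s) • v (Fin.last m) with ha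
  have hav : (s / L (Fin.last m)) • a = v (Fin.last m) := by
    rw [ha, smul_smul, div_mul_div_cancel₀ hb, div_self hs, one_smul]
  have hiff : alignedDifferential L s ε e p v = 0 ↔ alignedShift L s ε a = v := by
    rw [alignedDifferential_apply]
    have hu : inner ℝ u (v (Fin.last m)) = 0 := h.inner_u_last hv1 hv2
    have he : inner ℝ e (v (Fin.last m)) = 0 := h.inner_e_of_inner_u hu (hv1 _)
    have h1 : ∀ i, (ε i / s) • L (Fin.last m) • v (Fin.last m) = ε i • a := by
      intro i
      rw [ha, smul_smul, smul_smul]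
      congr 1
      ring
    simp only [h1, hv1, he, mul_zero, Prod.ext_iff, Prod.fst_zero, Prod.snd_zero, and_self,
      and_true, funext_iff, Pi.zero_apply, Fin.forall_fin_succ', alignedShift_castSucc,
      alignedShift_last, hav, sub_eq_zero]
    exact forall_congr' fun i => eq_comm
  rw [hiff]
  constructor
  · intro hrad
    set v' := v - alignedShift L s ε a with hv'
    have hau : inner ℝ u a = 0 := by
      rw [ha, real_inner_smul_right, h.inner_u_last hv1 hv2, mul_zero]
    have hv'u : ∀ i : Fin m, inner ℝ u (v' i.castSucc) = 0 := by
      intro i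
      simp [hv', inner_sub_right, h.inner_u_castSucc hv1 i, real_inner_smul_right, hau]
    have hv'last : v' (Fin.last m) = 0 := by simp [hv', hav]
    have hv'sum : ∑ i, L i • v' i = 0 := by
      simp [hv', smul_sub, Finset.sum_sub_distrib, hv2, h.sum_alignedShift]
    set q := inner ℝ u (p (Fin.last m)) with hq
    set y' := p (Fin.last m) - q • u with hy'
    have hy'u : inner ℝ u y' = 0 := by
      rw [hy', inner_sub_right, real_inner_smul_right, h.inner_u_u, hq]
      ring
    have hy'y : inner ℝ (p (Fin.last m)) y' = 1 - q ^ 2 := by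
      rw [hy', inner_sub_right, real_inner_smul_right, h.inner_p_p,
        real_inner_comm u (p (Fin.last m)), ← hq]
      ring
    have hq1 : 1 - q ^ 2 ≠ 0 := by linarith [h.indep_u_last]
    set t := (L (Fin.last m))⁻¹ • ∑ i : Fin m, L i.castSucc • ε i • v' i.castSucc with ht
    set r := inner ℝ (p (Fin.last m)) t / (s / L (Fin.last m) * (1 - q ^ 2)) with hr
    have hrt : r * (s / L (Fin.last m) * (1 - q ^ 2)) = inner ℝ (p (Fin.last m)) t := by
      rw [hr]
      field_simp
    -- Flipping the signs ε_i in v' makes the pairing with v' a definite sum; the last entry -t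
    -- restores closure. Adding r times the shift of y' makes the last component orthogonal to the
    -- last link. It keeps the other links tangent, as y' ⟂ u, and does not change the pairing.
    let v'' : Fin (m + 1) → V := Fin.snoc (α := fun _ => V) (fun i => ε i • v' i.castSucc) (-t)
    have hsum'' : ∑ i, L i • v'' i = 0 := by
      rw [Fin.sum_univ_castSucc]
      simp [v'', ht, smul_inv_smul₀ hb]
    have hmem : v'' + r • alignedShift L s ε y' ∈
        LinearMap.ker (chainDifferential L p).toLinearMap := by
      rw [mem_ker_chainDifferential]
      constructor
      · intro i
        induction i using Fin.lastCases with
        | last =>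
          simp only [v'', Pi.add_apply, Fin.snoc_last, Pi.smul_apply, alignedShift_last,
            inner_add_right, inner_neg_right, real_inner_smul_right, hy'y]
          linarith
        | cast i =>
          simp [v'', h.castSucc, inner_add_right, real_inner_smul_right, real_inner_smul_left,
            hy'u, hv'u]
      · simp only [Pi.add_apply, Pi.smul_apply, smul_add, Finset.sum_add_distrib, hsum'',
          smul_comm _ r, ← Finset.smul_sum, h.sum_alignedShift, smul_zero, add_zero]
    have h1 := hrad _ hmem
    have hdecomp : v = v' + alignedShift L s ε a := by rw [hv', sub_add_cancel]
    have h2 : alignedForm V L c s ε v' (alignedShift L s ε y') = 0 := by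
      rw [alignedForm_symm]
      exact h.alignedForm_alignedShift y' hv'sum
    rw [hdecomp, map_add (alignedForm V L c s ε), add_apply,
      h.alignedForm_alignedShift a (mem_ker_chainDifferential.1 hmem).2, add_zero, map_add,
      map_smul, h2, smul_zero, add_zero, alignedForm_apply, hv'last, inner_zero_left, mul_zero,
      add_zero] at h1
    have h3 : ∑ i : Fin m, L i.castSucc * inner ℝ (v' i.castSucc) (v' i.castSucc) = 0 := by
      have hc := h.c_pos.ne'
      rcases mul_eq_zero.1 h1 with h4 | h4
      · simp [hc] at h4
      · rw [← (mul_eq_zero.1 h4).resolve_left hs]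
        refine Finset.sum_congr rfl fun i _ => ?_
        simp only [v'', Fin.snoc_castSucc, real_inner_smul_right]
        linear_combination (-L i.castSucc * inner ℝ (v' i.castSucc) (v' i.castSucc)) *
          h.eps_mul_self i
    rw [Finset.sum_eq_zero_iff_of_nonneg fun i _ =>
      mul_nonneg (h.L_pos _).le real_inner_self_nonneg] at h3
    have h5 : v' = 0 := by
      funext i
      induction i using Fin.lastCases with
      | last => exact hv'last
      | cast i =>
        exact inner_self_eq_zero.1
          ((mul_eq_zero.1 (h3 i (Finset.mem_univ i))).resolve_left (h.L_pos _).ne')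
    rw [hdecomp, h5, zero_add]
  · intro hk w hw
    rw [← hk]
    exact h.alignedForm_alignedShift a (mem_ker_chainDifferential.1 hw).2

end IsAlignedAt

end AlignedHessian

/-! ### The index of the Hessian and the Morse-Bott property -/

section AlignedIndex

variable {V : Type*} [NormedAddCommGroup V] [InnerProductSpace ℝ V]
  {m : ℕ} {L : Fin (m + 1) → ℝ} {c s : ℝ} {ε : Fin m → ℝ} {e u : V} {p : Fin (m + 1) → V}

/-- The Hessian of the height function on the tangent space of the chain space at `p`. -/
def alignedHessian (L : Fin (m + 1) → ℝ) (c s : ℝ) (ε : Fin m → ℝ) (p : Fin (m + 1) → V) :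
    LinearMap.BilinForm ℝ (LinearMap.ker (chainDifferential L p).toLinearMap) :=
  LinearMap.mk₂ ℝ (fun v w => 2 * alignedForm V L c s ε v w)
    (fun _ _ _ => by simp [mul_add]) (fun _ _ _ => by simp [mul_left_comm])
    (fun _ _ _ => by simp [mul_add]) (fun _ _ _ => by simp [mul_left_comm])

theorem alignedHessian_apply
    (v w : LinearMap.ker (chainDifferential L p).toLinearMap) :
    alignedHessian L c s ε p v w = 2 * alignedForm V L c s ε v w := rfl

/-- The differences of the variations of the negatively aligned links to that of the link `i₀`. -/
def negativeDifferences (h : IsAlignedAt L c s ε e u p) (i₀ : Fin m) :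
    LinearMap.ker (chainDifferential L p).toLinearMap →ₗ[ℝ]
      ({i : Fin m // ε i = -1 ∧ i ≠ i₀} → (ℝ ∙ u)ᗮ) where
  toFun v i := ⟨v.1 i.1.castSucc - v.1 i₀.castSucc, by
    have hv := (mem_ker_chainDifferential.1 v.2).1
    rw [Submodule.mem_orthogonal_singleton_iff_inner_right, inner_sub_right,
      h.inner_u_castSucc hv, h.inner_u_castSucc hv, sub_zero]⟩
  map_add' v w := by
    ext i
    simp only [Submodule.coe_add, Pi.add_apply]
    abel
  map_smul' r v := by
    ext i
    simp [smul_sub]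

/-- The extension by zero of a variation of the links indexed by a subtype. -/
def extendVariation {q : Fin m → Prop} [DecidablePred q] (n : {i : Fin m // q i} → (ℝ ∙ u)ᗮ)
    (k : Fin m) : V :=
  if hk : q k then (n ⟨k, hk⟩ : V) else 0

/-- The tangent vector of the chain space in which the negatively aligned links other than `i₀`
have a prescribed variation, compensated by the link `i₀`. -/
def negativeVariation (h : IsAlignedAt L c s ε e u p) (i₀ : Fin m) :
    ({i : Fin m // ε i = -1 ∧ i ≠ i₀} → (ℝ ∙ u)ᗮ) →ₗ[ℝ]
      LinearMap.ker (chainDifferential L p).toLinearMap where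
  toFun n := ⟨Fin.snoc (α := fun _ => V) (fun k => extendVariation n k -
    if k = i₀ then (L i₀.castSucc)⁻¹ • ∑ j : Fin m, L j.castSucc • extendVariation n j else 0) 0, by
    have hn : ∀ k, inner ℝ u (extendVariation n k) = 0 := by
      intro k
      unfold extendVariation
      split_ifs with hk
      · exact Submodule.mem_orthogonal_singleton_iff_inner_right.1 (n ⟨k, hk⟩).2
      · simp
    rw [mem_ker_chainDifferential]
    constructor
    · intro i
      induction i using Fin.lastCases with
      | last => simp
      | cast i =>
        rw [h.castSucc, Fin.snoc_castSucc, real_inner_smul_left, inner_sub_right, hn]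
        split_ifs
        · simp [real_inner_smul_right, inner_sum, hn]
        · simp
    · rw [Fin.sum_univ_castSucc]
      simp [smul_sub, Finset.sum_sub_distrib, smul_inv_smul₀ (h.L_pos _).ne']⟩
  map_add' n n' := by
    have hadd : ∀ k, extendVariation (n + n') k = extendVariation n k + extendVariation n' k := by
      intro k
      unfold extendVariation
      split_ifs <;> simp
    ext i
    induction i using Fin.lastCases with
    | last => simp
    | cast i =>
      simp only [Submodule.coe_add, Pi.add_apply, Fin.snoc_castSucc, hadd, smul_add,
        Finset.sum_add_distrib]
      split_ifs <;> abel
  map_smul' r n := by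
    have hsmul : ∀ k, extendVariation (r • n) k = r • extendVariation n k := by
      intro k
      unfold extendVariation
      split_ifs <;> simp
    ext i
    induction i using Fin.lastCases with
    | last => simp
    | cast i =>
      simp only [Submodule.coe_smul, Pi.smul_apply, Fin.snoc_castSucc, hsmul, RingHom.id_apply,
        smul_comm _ r, ← Finset.smul_sum, smul_sub]
      split_ifs <;> simp

/-- All negatively aligned links have the same variation, so one shift cancels them all. The shift
is B-orthogonal to closed variations, so the value of the form is unchanged, and only nonnegative
terms remain. -/
theorem alignedHessian_nonneg (h : IsAlignedAt L c s ε e u p) {i₀ : Fin m}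
    {v : LinearMap.ker (chainDifferential L p).toLinearMap}
    (hv : negativeDifferences h i₀ v = 0) : 0 ≤ alignedHessian L c s ε p v v := by
  obtain ⟨v, hvT⟩ := v
  obtain ⟨hv1, hv2⟩ := mem_ker_chainDifferential.1 hvT
  have hv' : ∀ i : Fin m, ε i = -1 → v i.castSucc = v i₀.castSucc := by
    intro i hi
    by_cases hii : i = i₀
    · rw [hii]
    · exact sub_eq_zero.1 (congrArg Subtype.val (congrFun hv ⟨i, hi, hii⟩))
  rw [alignedHessian_apply]
  set a := -v i₀.castSucc with ha
  set v' := v - alignedShift L s ε a with hv'def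
  have hdecomp : v = v' + alignedShift L s ε a := by rw [hv'def, sub_add_cancel]
  have hv'sum : ∑ i, L i • v' i = 0 := by
    simp [hv'def, smul_sub, Finset.sum_sub_distrib, hv2, h.sum_alignedShift]
  have h1 : alignedForm V L c s ε v v = alignedForm V L c s ε v' v' := by
    have h2 := h.alignedForm_alignedShift a hv2
    have h3 := h.alignedForm_alignedShift a hv'sum
    rw [alignedForm_symm] at h3
    nth_rewrite 1 [hdecomp]
    rw [map_add (alignedForm V L c s ε), add_apply, h2, add_zero]
    nth_rewrite 1 [hdecomp]
    rw [map_add, h3, add_zero]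
  have hc := h.c_pos
  rw [h1, alignedForm_apply]
  refine mul_nonneg zero_le_two (mul_nonneg (by positivity) (add_nonneg
    (mul_nonneg h.s_pos.le (Finset.sum_nonneg fun i _ => ?_))
    (mul_nonneg (sq_nonneg _) real_inner_self_nonneg)))
  rcases h.eps i with hi | hi
  · rw [hi, one_mul]
    exact mul_nonneg (h.L_pos _).le real_inner_self_nonneg
  · have : v' i.castSucc = 0 := by simp [hv'def, hi, hv' i hi, ha]
    simp [this]

/-- Only negatively aligned links move here and the last link is at rest, so every nonzero term of
the form has a negative weight. -/
theorem alignedHessian_neg (h : IsAlignedAt L c s ε e u p) {i₀ : Fin m} (hi₀ : ε i₀ = -1)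
    {n : {i : Fin m // ε i = -1 ∧ i ≠ i₀} → (ℝ ∙ u)ᗮ} (hn : n ≠ 0) :
    alignedHessian L c s ε p (negativeVariation h i₀ n) (negativeVariation h i₀ n) < 0 := by
  set v : Fin (m + 1) → V := (negativeVariation h i₀ n).1 with hv
  have hlast : v (Fin.last m) = 0 := by simp [hv, negativeVariation]
  have hpos : ∀ k, ε k = 1 → v k.castSucc = 0 := by
    intro k hk
    have h1 : ε k ≠ -1 := by rw [hk]; norm_num
    have h2 : k ≠ i₀ := by rintro rfl; exact h1 hi₀
    simp [hv, negativeVariation, extendVariation, h1, h2]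
  have hneg : ∀ k, v k.castSucc ≠ 0 → ε k = -1 :=
    fun k hk => (h.eps k).resolve_left fun h1 => hk (hpos k h1)
  obtain ⟨j, hj⟩ := Function.ne_iff.1 hn
  have hvj : v j.1.castSucc ≠ 0 := by
    have : v j.1.castSucc = n j := by
      simp [hv, negativeVariation, extendVariation, j.2.1, j.2.2]
    rw [this]
    exact fun h0 => hj (Subtype.ext h0)
  have hc := h.c_pos
  have hsum : ∑ k : Fin m, ε k * L k.castSucc * inner ℝ (v k.castSucc) (v k.castSucc) < 0 := by
    have hterm : ∀ k : Fin m, v k.castSucc ≠ 0 →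
        ε k * L k.castSucc * inner ℝ (v k.castSucc) (v k.castSucc) < 0 := by
      intro k hk
      rw [hneg k hk, neg_one_mul, neg_mul, neg_lt_zero]
      exact mul_pos (h.L_pos _) (real_inner_self_pos.2 hk)
    refine Finset.sum_neg' (fun k _ => ?_) ⟨j.1, Finset.mem_univ _, hterm _ hvj⟩
    by_cases hk : v k.castSucc = 0
    · simp [hk]
    · exact (hterm k hk).le
  rw [alignedHessian_apply, ← hv, alignedForm_apply, hlast, inner_zero_left, mul_zero, add_zero]
  have h2c : 0 < 2 * ((2 * c)⁻¹ * s) := by have := h.s_pos; positivity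
  have := mul_neg_of_pos_of_neg h2c hsum
  linarith

/-- Each negatively aligned link other than i₀ contributes the hyperplane orthogonal to u. -/
theorem sigNeg_alignedHessian [FiniteDimensional ℝ V] (h : IsAlignedAt L c s ε e u p) :
    (sigNeg (LinearMap.BilinMap.toQuadraticMap (alignedHessian L c s ε p)) : ℤ) =
      ((Finset.univ.filter fun i => ε i = -1).card - 1) * ((Module.finrank ℝ V : ℤ) - 1) := by
  obtain ⟨i₀, hi₀⟩ := h.exists_eps_neg
  rw [sigNeg_eq_finrank _ (negativeDifferences h i₀) (negativeVariation h i₀)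
    (fun v hv => alignedHessian_nonneg h hv) (fun n hn => alignedHessian_neg h hi₀ hn)]
  have hu : u ≠ 0 := by
    intro h0
    simpa [h0] using h.u_norm
  have h1 := Submodule.finrank_add_finrank_orthogonal (ℝ ∙ u)
  rw [finrank_span_singleton hu] at h1
  have h2 : Fintype.card {i : Fin m // ε i = -1 ∧ i ≠ i₀} + 1 =
      (Finset.univ.filter fun i => ε i = -1).card := by
    rw [Fintype.card_subtype, ← Finset.card_erase_add_one
      (show i₀ ∈ Finset.univ.filter fun i => ε i = -1 by simpa using hi₀)]
    congr 2
    ext i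
    simp [and_comm]
  rw [Module.finrank_pi_fintype, Finset.sum_const, Finset.card_univ, smul_eq_mul, ← h2, ← h1]
  push_cast
  ring

/-- A compact piece of the set of aligned chains is a Morse-Bott critical submanifold. -/
theorem isMorseBottCritical_of_subset_alignedSet [FiniteDimensional ℝ V] {κ : ℝ}
    (hL : ∀ i, 0 < L i) (hc : 0 < c) (hs : 0 < s) (hε : ∀ i, ε i = 1 ∨ ε i = -1)
    (hsum : ∑ i : Fin m, ε i * L i.castSucc = -s) (he : ‖e‖ = 1)
    (hκs : s ^ 2 = L (Fin.last m) ^ 2 + c ^ 2 + 2 * L (Fin.last m) * c * κ) (hκ : κ ^ 2 < 1)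
    {S : Set (Fin (m + 1) → V)} (hS : S ⊆ alignedSet L c s ε e κ) (hclosed : IsClosed S)
    (hne : S.Nonempty) (hopen : ∀ p ∈ S, ∀ᶠ q in 𝓝 p, q ∈ alignedSet L c s ε e κ → q ∈ S) :
    IsMorseBottCritical (chainSet L c e)
      (fun z => L (Fin.last m) * inner ℝ (z (Fin.last m)) e + c) S
      (m * ((Module.finrank ℝ V : ℤ) - 1) - 1) ((Module.finrank ℝ V : ℤ) - 2)
      (((Finset.univ.filter fun i => ε i = -1).card - 1) * ((Module.finrank ℝ V : ℤ) - 1)) := by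
  have hal : ∀ p ∈ S, IsAlignedAt L c s ε e (s⁻¹ • (L (Fin.last m) • p (Fin.last m) + c • e)) p :=
    fun p hp => isAlignedAt_of_mem_alignedSet hL hc hs hε hsum he hκs hκ (hS hp)
  refine ⟨fun p hp => (hal p hp).mem, ?_, hne, fun p hp => ?_⟩
  · refine Metric.isCompact_of_isClosed_isBounded hclosed ?_
    refine (Metric.isBounded_closedBall (x := (0 : Fin (m + 1) → V)) (r := 1)).subset fun p hp => ?_
    rw [mem_closedBall_zero_iff, pi_norm_le_iff_of_nonneg zero_le_one]
    exact fun i => ((hal p hp).mem.1 i).le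
  have h := hal p hp
  have hM : ∀ᶠ q in 𝓝 p, q ∈ chainSet L c e ↔ chainEquation L c e q = 0 :=
    Eventually.of_forall fun q => mem_chainSet_iff
  -- As S is relatively open in the aligned set, both have the same equations near p. This allows S
  -- to be a single point when d = 2.
  have hSev : ∀ᶠ q in 𝓝 p, q ∈ S ↔ alignedEquation L c s ε e κ q = 0 := by
    filter_upwards [hopen p hp] with q hq
    rw [← mem_alignedSet_iff]
    exact ⟨fun h' => hS h', hq⟩
  have hquad : ∀ z ∈ chainSet L c e, L (Fin.last m) * inner ℝ (z (Fin.last m)) e + c =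
      L (Fin.last m) * inner ℝ (p (Fin.last m)) e + c + alignedForm V L c s ε (z - p) (z - p) :=
    fun z hz => h.height_eq hz
  have hTM := tangentVectors_eq_ker (contDiff_chainEquation L c e)
    (hasFDerivAt_chainEquation L c e p) h.surjective_chainDifferential h.mem hM
  have hTS := tangentVectors_eq_ker (contDiff_alignedEquation L c s ε e κ)
    (hasFDerivAt_alignedEquation L c s ε e κ p) h.surjective_alignedDifferential hp hSev
  refine ⟨?_, ?_, ?_, LinearMap.ker (chainDifferential L p).toLinearMap,
    alignedHessian L c s ε p, ⟨?_, ?_, ?_⟩, ?_, sigNeg_alignedHessian h⟩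
  · have h1 := isSubmanifoldAt_of_surjective (contDiff_chainEquation L c e)
      (hasFDerivAt_chainEquation L c e p) h.surjective_chainDifferential h.mem hM
    convert h1 using 1
    simp only [Module.finrank_prod, Module.finrank_pi_fintype, Finset.sum_const, Finset.card_univ,
      Fintype.card_fin, Module.finrank_self, smul_eq_mul]
    push_cast
    ring
  · have h1 := isSubmanifoldAt_of_surjective (contDiff_alignedEquation L c s ε e κ)
      (hasFDerivAt_alignedEquation L c s ε e κ p) h.surjective_alignedDifferential hp hSev
    convert h1 using 1
    simp only [Module.finrank_prod, Module.finrank_pi_fintype, Finset.sum_const, Finset.card_univ,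
      Fintype.card_fin, Module.finrank_self, smul_eq_mul]
    push_cast
    ring
  · intro γ hγ
    have hd : DifferentiableAt ℝ γ 0 := hγ.1.differentiableAt (by simp)
    exact (hasDerivAt_comp_curve _ (alignedForm_symm L c s ε) hquad hγ hd.hasDerivAt).1
  · rw [hTM]
    rfl
  · intro v w
    rw [alignedHessian_apply, alignedHessian_apply, alignedForm_symm]
  · intro γ v hγ hv
    exact (hasDerivAt_comp_curve _ (alignedForm_symm L c s ε) hquad hγ hv).2
  · intro v
    rw [hTS]
    refine Iff.trans ?_ (h.alignedForm_radical v.2)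
    simp [alignedHessian_apply]

end AlignedIndex

/-! ### Transitivity on aligned chains -/

section AlignedOrbit

variable {V : Type*} [NormedAddCommGroup V] [InnerProductSpace ℝ V]
  {m : ℕ} {L : Fin (m + 1) → ℝ} {c s : ℝ} {ε : Fin m → ℝ} {e : V} {κ : ℝ}

theorem alignedSet_ext {w z : Fin (m + 1) → V} (hw : w ∈ alignedSet L c s ε e κ)
    (hz : z ∈ alignedSet L c s ε e κ) (h : w (Fin.last m) = z (Fin.last m)) : w = z := by
  funext i
  induction i using Fin.lastCases with
  | last => exact h
  | cast i => rw [hw.1, hz.1, h]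

theorem map_mem_alignedSet {z : Fin (m + 1) → V} (hz : z ∈ alignedSet L c s ε e κ)
    (A : V ≃ₗᵢ[ℝ] V) (hA : A e = e) : (fun i => A (z i)) ∈ alignedSet L c s ε e κ := by
  refine ⟨fun i => ?_, ?_, ?_⟩
  · change A (z _) = (ε i / s) • (L (Fin.last m) • A (z _) + c • e)
    rw [hz.1, map_smul, map_add, map_smul, map_smul, hA]
  · change ‖A (z _)‖ = 1
    rw [A.norm_map, hz.2.1]
  · change inner ℝ (A (z _)) e = κ
    rw [← hz.2.2]
    nth_rewrite 1 [← hA]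
    exact A.inner_map_map _ _

theorem det_reflection_orthogonal_singleton [FiniteDimensional ℝ V] {v : V} (hv : v ≠ 0) :
    LinearEquiv.det ((ℝ ∙ v)ᗮ.reflection).toLinearEquiv = -1 := by
  have h := (ℝ ∙ v)ᗮ.linearEquiv_det_reflection
  rw [Submodule.orthogonal_orthogonal, finrank_span_singleton hv, pow_one] at h
  exact h

/-- The isometries that fix `e` act transitively on the set of aligned chains. -/
theorem exists_isometry_map_eq [FiniteDimensional ℝ V] {w z : Fin (m + 1) → V}
    (hw : w ∈ alignedSet L c s ε e κ) (hz : z ∈ alignedSet L c s ε e κ) :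
    ∃ A : V ≃ₗᵢ[ℝ] V, A e = e ∧ (w = fun i => A (z i)) ∧
      (A = 1 ∨ LinearEquiv.det A.toLinearEquiv = -1) := by
  by_cases h : z (Fin.last m) = w (Fin.last m)
  · exact ⟨1, rfl, alignedSet_ext hw hz h.symm, Or.inl rfl⟩
  -- The reflection exchanging the two last links fixes e, because both have inner product κ with e.
  · have he : (ℝ ∙ (z (Fin.last m) - w (Fin.last m)))ᗮ.reflection e = e := by
      apply Submodule.reflection_mem_subspace_eq_self
      rw [Submodule.mem_orthogonal_singleton_iff_inner_right, inner_sub_left, hz.2.2, hw.2.2,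
        sub_self]
    refine ⟨(ℝ ∙ (z (Fin.last m) - w (Fin.last m)))ᗮ.reflection, he, ?_,
      Or.inr (det_reflection_orthogonal_singleton (sub_ne_zero.2 h))⟩
    refine alignedSet_ext hw (map_mem_alignedSet hz _ he) ?_
    exact (Submodule.reflection_sub (by rw [hz.2.1, hw.2.1])).symm

end AlignedOrbit

/-! ### The coordinate plane and rotations for d = 2 -/

section Coordinates

theorem Fin.val_one_of_two_le {d : ℕ} [NeZero d] (hd : 2 ≤ d) : ((1 : Fin d) : ℕ) = 1 := by
  rw [Fin.val_one', Nat.mod_eq_of_lt hd]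

theorem Fin.one_ne_zero_of_two_le {d : ℕ} [NeZero d] (hd : 2 ≤ d) : (1 : Fin d) ≠ 0 := by
  intro h
  have h1 := congrArg Fin.val h
  rw [Fin.val_one_of_two_le hd] at h1
  simp at h1

theorem norm_e₁ (d : ℕ) [NeZero d] : ‖e₁ d‖ = 1 := by
  simp [e₁]

theorem inner_e₁ {d : ℕ} [NeZero d] (x : EuclideanSpace ℝ (Fin d)) :
    inner ℝ x (e₁ d) = x 0 := by
  simp [e₁, EuclideanSpace.inner_single_right]

theorem norm_sq_of_plane {d : ℕ} [NeZero d] (hd : 2 ≤ d) {x : EuclideanSpace ℝ (Fin d)}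
    (hx : ∀ j : Fin d, 2 ≤ (j : ℕ) → x j = 0) : ‖x‖ ^ 2 = x 0 ^ 2 + x 1 ^ 2 := by
  have h1 := Fin.val_one_of_two_le hd
  rw [EuclideanSpace.norm_sq_eq, Fintype.sum_eq_add 0 1]
  · simp
  · exact (Fin.one_ne_zero_of_two_le hd).symm
  · rintro j ⟨hj0, hj1⟩
    rw [hx j, norm_zero, zero_pow two_ne_zero]
    by_contra! hj
    have h2 : (j : ℕ) ≠ 0 := fun h => hj0 (Fin.ext (by simpa using h))
    have h3 : (j : ℕ) ≠ 1 := fun h => hj1 (Fin.ext (by rw [h, h1]))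
    omega

theorem eq_of_plane {d : ℕ} [NeZero d] (hd : 2 ≤ d) {x y : EuclideanSpace ℝ (Fin d)}
    (hx : ∀ j : Fin d, 2 ≤ (j : ℕ) → x j = 0) (hy : ∀ j : Fin d, 2 ≤ (j : ℕ) → y j = 0)
    (h0 : x 0 = y 0) (h1 : x 1 = y 1) : x = y := by
  ext j
  by_cases hj : 2 ≤ (j : ℕ)
  · rw [hx j hj, hy j hj]
  · have hj' : (j : ℕ) = 0 ∨ (j : ℕ) = 1 := by omega
    rcases hj' with h | h
    · rw [show j = 0 from Fin.ext (by simpa using h), h0]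
    · rw [show j = 1 from Fin.ext (by rw [h, Fin.val_one_of_two_le hd]), h1]

/-- Two vectors of the coordinate plane with the same norm, first coordinate and sign of the second
coordinate are equal. -/
theorem eq_of_plane_of_norm {d : ℕ} [NeZero d] (hd : 2 ≤ d) {x y : EuclideanSpace ℝ (Fin d)}
    (hx : ∀ j : Fin d, 2 ≤ (j : ℕ) → x j = 0) (hy : ∀ j : Fin d, 2 ≤ (j : ℕ) → y j = 0)
    (h0 : x 0 = y 0) (hx1 : x 1 < 0) (hy1 : y 1 < 0) (hnorm : ‖x‖ = ‖y‖) : x = y := by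
  refine eq_of_plane hd hx hy h0 ?_
  have h : x 0 ^ 2 + x 1 ^ 2 = y 0 ^ 2 + y 1 ^ 2 := by
    rw [← norm_sq_of_plane hd hx, ← norm_sq_of_plane hd hy, hnorm]
  rw [h0, add_right_inj, sq_eq_sq_iff_eq_or_eq_neg] at h
  rcases h with h | h
  · exact h
  · linarith

theorem exists_plane_vector {d : ℕ} [NeZero d] (hd : 2 ≤ d) {a : ℝ} (ha : a ^ 2 < 1) :
    ∃ x : EuclideanSpace ℝ (Fin d), ‖x‖ = 1 ∧ x 0 = a ∧ x 1 < 0 ∧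
      ∀ j : Fin d, 2 ≤ (j : ℕ) → x j = 0 := by
  have h1 := Fin.val_one_of_two_le hd
  have h01 : (1 : Fin d) ≠ 0 := Fin.one_ne_zero_of_two_le hd
  let x : EuclideanSpace ℝ (Fin d) :=
    WithLp.toLp 2 fun j => if j = 0 then a else if j = 1 then -√(1 - a ^ 2) else 0
  have hx0 : x 0 = a := by simp [x]
  have hx1 : x 1 = -√(1 - a ^ 2) := by simp [x, h01]
  have hx2 : ∀ j : Fin d, 2 ≤ (j : ℕ) → x j = 0 := by
    intro j hj
    have hj0 : j ≠ 0 := by rintro rfl; simp at hj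
    have hj1 : j ≠ 1 := by rintro rfl; omega
    simp [x, hj0, hj1]
  refine ⟨x, ?_, hx0, ?_, hx2⟩
  · rw [← pow_eq_one_iff_of_nonneg (norm_nonneg _) two_ne_zero, norm_sq_of_plane hd hx2, hx0, hx1,
      neg_sq, Real.sq_sqrt (by linarith)]
    ring
  · rw [hx1, neg_lt_zero]
    exact Real.sqrt_pos.2 (by linarith)

/-- The image of the second basis vector is orthogonal to the fixed first one, so the determinant is
its second coordinate. -/
theorem eq_one_of_mem_rotFix_two {A : EuclideanSpace ℝ (Fin 2) ≃ₗᵢ[ℝ] EuclideanSpace ℝ (Fin 2)}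
    (hA : A ∈ rotFix 2) : A = 1 := by
  obtain ⟨hA0 : A (e₁ 2) = e₁ 2, hdet⟩ := hA
  have hA0' : A (EuclideanSpace.single 0 1) = EuclideanSpace.single 0 1 := hA0
  have h0 : A (EuclideanSpace.single 1 1) 0 = 0 := by
    rw [← inner_e₁, ← hA0, A.inner_map_map, inner_e₁]
    simp
  have h1 : A (EuclideanSpace.single 1 1) 1 = 1 := by
    have h2 : LinearMap.det (A.toLinearEquiv : EuclideanSpace ℝ (Fin 2) →ₗ[ℝ] _) = 1 := by
      rw [← LinearEquiv.coe_det, hdet, Units.val_one]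
    rw [← LinearMap.det_toMatrix (EuclideanSpace.basisFun (Fin 2) ℝ).toBasis,
      Matrix.det_fin_two] at h2
    simpa [LinearMap.toMatrix_apply, hA0', h0] using h2
  ext x j
  have hx : x = x 0 • EuclideanSpace.single 0 1 + x 1 • EuclideanSpace.single 1 1 := by
    ext j
    fin_cases j <;> simp
  have hA1 : A (EuclideanSpace.single 1 1) = EuclideanSpace.single 1 1 := by
    ext j
    fin_cases j
    · simpa using h0
    · simpa using h1
  change A x j = x j
  conv_lhs => rw [hx, map_add, map_smul, map_smul, hA0', hA1, ← hx]

end Coordinates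

/-! ### Existence and uniqueness of the planar aligned chain -/

section AlignedChains

variable {m d : ℕ} [NeZero d]

/-- The sign with which the link `i` is aligned, determined by `J`. -/
def alignedSign (J : Finset (Fin (m + 2))) (i : Fin m) : ℝ :=
  if i.castSucc.castSucc ∈ J then 1 else -1

theorem alignedSign_eq (J : Finset (Fin (m + 2))) (i : Fin m) :
    alignedSign J i = 1 ∨ alignedSign J i = -1 := by
  unfold alignedSign
  split_ifs <;> simp

theorem card_alignedSign_neg {J : Finset (Fin (m + 2))} (hJ : ∀ j ∈ J, (j : ℕ) < m) :
    ((Finset.univ.filter fun i : Fin m => alignedSign J i = -1).card : ℤ) = m - J.card := by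
  have h1 : (Finset.univ.filter fun i : Fin m => alignedSign J i = -1) =
      Finset.univ.filter fun i : Fin m => ¬ i.castSucc.castSucc ∈ J := by
    ext i
    by_cases h : i.castSucc.castSucc ∈ J <;> simp [alignedSign, h]
    norm_num
  have h2 : J.card = (Finset.univ.filter fun i : Fin m => i.castSucc.castSucc ∈ J).card := by
    symm
    refine Finset.card_bij (fun i _ => i.castSucc.castSucc) (by simp) (by simp) ?_
    intro j hj
    exact ⟨⟨j, hJ j hj⟩, by simpa using hj, rfl⟩
  have h3 := Finset.card_filter_add_card_filter_not (s := (Finset.univ : Finset (Fin m)))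
    fun i => i.castSucc.castSucc ∈ J
  rw [Finset.card_univ, Fintype.card_fin] at h3
  rw [h1, h2]
  omega

theorem isShort_iff_sum_neg {n : ℕ} {ℓ : Fin n → ℝ} {I : Finset (Fin n)} :
    IsShort ℓ I ↔ ∑ i, (if i ∈ I then ℓ i else -ℓ i) < 0 := by
  rw [IsShort, Finset.sum_ite, Finset.sum_neg_distrib, ← sub_eq_add_neg, sub_neg,
    Finset.filter_mem_eq_inter, Finset.univ_inter, Finset.filter_notMem_eq_sdiff,
    Finset.compl_eq_univ_sdiff]

/-- Together with `IsLong.neg_lt_add`, this supplies the strict triangle inequalities for the sides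
s, b, c. -/
theorem IsShort.lt_add {ℓ : Fin (m + 2) → ℝ} {J : Finset (Fin (m + 2))}
    (hJ : ∀ j ∈ J, (j : ℕ) < m) (hshort : IsShort ℓ (J ∪ {Fin.last (m + 1)})) :
    ∑ i : Fin m, alignedSign J i * ℓ i.castSucc.castSucc + ℓ (Fin.last (m + 1)) <
      ℓ (Fin.last m).castSucc := by
  rw [isShort_iff_sum_neg, Fin.sum_univ_castSucc, Fin.sum_univ_castSucc] at hshort
  have h1 : (Fin.last m).castSucc ∉ J := fun h => by simpa using hJ _ h
  have h2 : ∀ i : Fin m, (if i.castSucc.castSucc ∈ J then ℓ i.castSucc.castSucc else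
      -ℓ i.castSucc.castSucc) = alignedSign J i * ℓ i.castSucc.castSucc := by
    intro i
    unfold alignedSign
    split_ifs <;> ring
  simp only [Finset.mem_union, Finset.mem_singleton, Fin.castSucc_ne_last, or_false, h2, h1,
    if_false, or_true, if_true] at hshort
  linarith

theorem IsLong.neg_lt_add {ℓ : Fin (m + 2) → ℝ} {J : Finset (Fin (m + 2))}
    (hlong : IsLong ℓ (J ∪ {(Fin.last m).castSucc, Fin.last (m + 1)})) :
    -(∑ i : Fin m, alignedSign J i * ℓ i.castSucc.castSucc) <
      ℓ (Fin.last m).castSucc + ℓ (Fin.last (m + 1)) := by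
  rw [IsLong, isShort_iff_sum_neg, Fin.sum_univ_castSucc, Fin.sum_univ_castSucc] at hlong
  have h2 : ∀ i : Fin m, (if i.castSucc.castSucc ∉ J then ℓ i.castSucc.castSucc else
      -ℓ i.castSucc.castSucc) = -(alignedSign J i * ℓ i.castSucc.castSucc) := by
    intro i
    unfold alignedSign
    split_ifs <;> ring
  have h3 : ∀ i : Fin m, i.castSucc.castSucc ≠ (Fin.last m).castSucc := by
    intro i h
    exact Fin.castSucc_ne_last i (Fin.castSucc_injective _ h)
  simp only [Finset.mem_compl, Finset.mem_union, Finset.mem_insert, Finset.mem_singleton,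
    Fin.castSucc_ne_last, or_false, h2, h3, or_true, not_true_eq_false,
    if_false, Finset.sum_neg_distrib] at hlong
  linarith

theorem heightF_eq (ℓ : Fin (m + 2) → ℝ) : heightF d ℓ =
    fun z => ℓ (Fin.last m).castSucc * inner ℝ (z (Fin.last m)) (e₁ d) +
      ℓ (Fin.last (m + 1)) := by
  funext z
  rw [inner_e₁, heightF]

section Aligned

variable {ℓ : Fin (m + 2) → ℝ} {J : Finset (Fin (m + 2))} {s κ : ℝ}

theorem IsAligned.castSucc_eq {x : EuclideanSpace ℝ (Fin d)}
    {z : Fin (m + 1) → EuclideanSpace ℝ (Fin d)} (h : IsAligned ℓ J x z) (i : Fin m) :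
    z i.castSucc = alignedSign J i • x := by
  unfold alignedSign
  split_ifs with hi
  · rw [h.2.2.2.2.2.1 i hi, one_smul]
  · rw [h.2.2.2.2.2.2 i hi, neg_one_smul]

theorem IsAligned.smul_eq (hsum : ∑ i : Fin m, alignedSign J i * ℓ i.castSucc.castSucc = -s)
    {x : EuclideanSpace ℝ (Fin d)} {z : Fin (m + 1) → EuclideanSpace ℝ (Fin d)}
    (h : IsAligned ℓ J x z) :
    s • x = ℓ (Fin.last m).castSucc • z (Fin.last m) + ℓ (Fin.last (m + 1)) • e₁ d := by
  have h1 := h.2.2.2.2.1.2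
  rw [Fin.sum_univ_castSucc] at h1
  simp only [h.castSucc_eq, smul_smul, ← Finset.sum_smul, mul_comm (ℓ _), hsum] at h1
  rw [neg_smul, neg_add_eq_iff_eq_add] at h1
  rw [h1]
  abel

/-- The law of cosines: the three side lengths determine the angle between the last link and e. -/
theorem IsAligned.inner_last (hpos : ∀ i, 0 < ℓ i)
    (hsum : ∑ i : Fin m, alignedSign J i * ℓ i.castSucc.castSucc = -s)
    (hκs : s ^ 2 = ℓ (Fin.last m).castSucc ^ 2 + ℓ (Fin.last (m + 1)) ^ 2 +
      2 * ℓ (Fin.last m).castSucc * ℓ (Fin.last (m + 1)) * κ)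
    {x : EuclideanSpace ℝ (Fin d)} {z : Fin (m + 1) → EuclideanSpace ℝ (Fin d)}
    (h : IsAligned ℓ J x z) : inner ℝ (z (Fin.last m)) (e₁ d) = κ := by
  have h1 := congrArg (fun y => inner ℝ y y) (h.smul_eq hsum)
  have hz := h.2.2.2.2.1.1 (Fin.last m)
  simp only [inner_add_left, inner_add_right, real_inner_smul_left, real_inner_smul_right,
    real_inner_comm (z (Fin.last m)) (e₁ d)] at h1
  rw [real_inner_self_eq_norm_sq, real_inner_self_eq_norm_sq, real_inner_self_eq_norm_sq, h.1, hz,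
    norm_e₁] at h1
  have hb := hpos (Fin.last m).castSucc
  have hc := hpos (Fin.last (m + 1))
  refine mul_left_cancel₀ (show 2 * ℓ (Fin.last m).castSucc * ℓ (Fin.last (m + 1)) ≠ 0 by
    positivity) ?_
  linarith

theorem IsAligned.mem_alignedSet (hpos : ∀ i, 0 < ℓ i) (hs : 0 < s)
    (hsum : ∑ i : Fin m, alignedSign J i * ℓ i.castSucc.castSucc = -s)
    (hκs : s ^ 2 = ℓ (Fin.last m).castSucc ^ 2 + ℓ (Fin.last (m + 1)) ^ 2 +
      2 * ℓ (Fin.last m).castSucc * ℓ (Fin.last (m + 1)) * κ)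
    {x : EuclideanSpace ℝ (Fin d)} {z : Fin (m + 1) → EuclideanSpace ℝ (Fin d)}
    (h : IsAligned ℓ J x z) :
    z ∈ alignedSet (fun i => ℓ i.castSucc) (ℓ (Fin.last (m + 1))) s (alignedSign J) (e₁ d) κ := by
  refine ⟨fun i => ?_, h.2.2.2.2.1.1 _, h.inner_last hpos hsum hκs⟩
  rw [h.castSucc_eq, ← h.smul_eq hsum, smul_smul, div_mul_cancel₀ _ hs.ne']

/-- The first coordinate of x is forced to be (b κ + c) / s, and the sign of the second selects one
of the two unit vectors; x then determines the last link. -/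
theorem IsAligned.unique (hd : 2 ≤ d) (hpos : ∀ i, 0 < ℓ i) (hs : 0 < s)
    (hsum : ∑ i : Fin m, alignedSign J i * ℓ i.castSucc.castSucc = -s)
    (hκs : s ^ 2 = ℓ (Fin.last m).castSucc ^ 2 + ℓ (Fin.last (m + 1)) ^ 2 +
      2 * ℓ (Fin.last m).castSucc * ℓ (Fin.last (m + 1)) * κ)
    {x x' : EuclideanSpace ℝ (Fin d)} {z z' : Fin (m + 1) → EuclideanSpace ℝ (Fin d)}
    (h : IsAligned ℓ J x z) (h' : IsAligned ℓ J x' z') : x = x' ∧ z = z' := by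
  have hz := h.inner_last hpos hsum hκs
  have hz' := h'.inner_last hpos hsum hκs
  have hx : x = x' := by
    refine eq_of_plane_of_norm hd h.2.2.2.1 h'.2.2.2.1 ?_ h.2.2.1 h'.2.2.1 (by rw [h.1, h'.1])
    have h1 := congrArg (fun y => inner ℝ y (e₁ d)) (h.smul_eq hsum)
    have h2 := congrArg (fun y => inner ℝ y (e₁ d)) (h'.smul_eq hsum)
    simp only [inner_add_left, real_inner_smul_left, hz, hz'] at h1 h2
    rw [← inner_e₁, ← inner_e₁]
    exact mul_left_cancel₀ hs.ne' (h1.trans h2.symm)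
  refine ⟨hx, alignedSet_ext (h.mem_alignedSet hpos hs hsum hκs)
    (h'.mem_alignedSet hpos hs hsum hκs) ?_⟩
  have h1 := h.smul_eq hsum
  rw [hx, h'.smul_eq hsum, add_left_inj] at h1
  exact smul_right_injective _ (hpos _).ne' h1.symm

theorem exists_isAligned (hd : 2 ≤ d) (hpos : ∀ i, 0 < ℓ i)
    (hdom : ℓ (Fin.last m).castSucc ≤ ℓ (Fin.last (m + 1))) (hs : 0 < s)
    (hsum : ∑ i : Fin m, alignedSign J i * ℓ i.castSucc.castSucc = -s)
    (hκs : s ^ 2 = ℓ (Fin.last m).castSucc ^ 2 + ℓ (Fin.last (m + 1)) ^ 2 +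
      2 * ℓ (Fin.last m).castSucc * ℓ (Fin.last (m + 1)) * κ) (hκ : κ ^ 2 < 1) :
    ∃ (x : EuclideanSpace ℝ (Fin d)) (z : Fin (m + 1) → EuclideanSpace ℝ (Fin d)),
      IsAligned ℓ J x z := by
  have hb := hpos (Fin.last m).castSucc
  have hc := hpos (Fin.last (m + 1))
  set b := ℓ (Fin.last m).castSucc with hbdef
  set c := ℓ (Fin.last (m + 1)) with hcdef
  have hsn := hs.ne'
  have ha : ((b * κ + c) / s) ^ 2 < 1 := by
    rw [div_pow, div_lt_one (by positivity), hκs]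
    have := mul_pos (pow_pos hb 2) (sub_pos.2 hκ)
    linarith
  -- By the law of cosines 2c (b κ + c) = s² + c² - b², which is positive because b ≤ c. This is
  -- what makes x_1 > 0.
  have ha0 : 0 < (b * κ + c) / s := by
    refine div_pos ?_ hs
    have h1 : 0 < 2 * c * (b * κ + c) := by
      have h2 : b ^ 2 ≤ c ^ 2 := by gcongr
      have h3 := pow_pos hs 2
      linarith
    exact pos_of_mul_pos_right h1 (by positivity)
  obtain ⟨x, hx, hx0, hx1, hx2⟩ := exists_plane_vector hd ha
  have hsx : s * x 0 = b * κ + c := by rw [hx0, mul_div_cancel₀ _ hsn]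
  let z : Fin (m + 1) → EuclideanSpace ℝ (Fin d) :=
    Fin.snoc (α := fun _ => EuclideanSpace ℝ (Fin d)) (fun i => alignedSign J i • x)
      (b⁻¹ • (s • x - c • e₁ d))
  refine ⟨x, z, hx, hx0 ▸ ha0, hx1, hx2, ⟨?_, ?_⟩, ?_, ?_⟩
  · intro i
    induction i using Fin.lastCases with
    | last =>
      simp only [z, Fin.snoc_last]
      rw [← pow_eq_one_iff_of_nonneg (norm_nonneg _) two_ne_zero, ← real_inner_self_eq_norm_sq]
      simp only [inner_sub_left, inner_sub_right, real_inner_smul_left, real_inner_smul_right,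
        real_inner_comm x (e₁ d), inner_e₁ x]
      rw [real_inner_self_eq_norm_sq, real_inner_self_eq_norm_sq, hx, norm_e₁]
      field_simp
      linear_combination (-2 * c) * hsx + hκs
    | cast i =>
      simp only [z, Fin.snoc_castSucc, norm_smul, hx]
      rcases alignedSign_eq J i with h | h <;> simp [h]
  · rw [Fin.sum_univ_castSucc]
    simp only [z, Fin.snoc_castSucc, Fin.snoc_last, smul_smul, ← Finset.sum_smul,
      mul_comm (ℓ _) (alignedSign _ _), hsum]
    rw [← hbdef, mul_inv_cancel₀ hb.ne']
    module
  · intro i hi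
    simp [z, alignedSign, hi]
  · intro i hi
    simp [z, alignedSign, hi]

theorem IsAligned.last_one_neg (hpos : ∀ i, 0 < ℓ i) (hd : 2 ≤ d) (hs : 0 < s)
    (hsum : ∑ i : Fin m, alignedSign J i * ℓ i.castSucc.castSucc = -s)
    {x : EuclideanSpace ℝ (Fin d)} {z : Fin (m + 1) → EuclideanSpace ℝ (Fin d)}
    (h : IsAligned ℓ J x z) : z (Fin.last m) 1 < 0 := by
  have h1 := congrArg (fun y : EuclideanSpace ℝ (Fin d) => y 1) (h.smul_eq hsum)
  simp [e₁, Fin.one_ne_zero_of_two_le hd] at h1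
  have h2 : ℓ (Fin.last m).castSucc * z (Fin.last m) 1 < 0 := by
    rw [← h1]
    exact mul_neg_of_pos_of_neg hs h.2.2.1
  exact neg_of_mul_neg_right h2 (hpos _).le

theorem IsAligned.apply_eq_zero (hpos : ∀ i, 0 < ℓ i)
    (hsum : ∑ i : Fin m, alignedSign J i * ℓ i.castSucc.castSucc = -s)
    {x : EuclideanSpace ℝ (Fin d)} {z : Fin (m + 1) → EuclideanSpace ℝ (Fin d)}
    (h : IsAligned ℓ J x z) {j : Fin d} (hj : 2 ≤ (j : ℕ)) (i : Fin (m + 1)) : z i j = 0 := by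
  induction i using Fin.lastCases with
  | last =>
    have hj0 : j ≠ 0 := by rintro rfl; simp at hj
    have h1 := congrArg (fun y : EuclideanSpace ℝ (Fin d) => y j) (h.smul_eq hsum)
    simp [e₁, hj0, h.2.2.2.1 j hj, (hpos _).ne'] at h1
    exact h1
  | cast i => simp [h.castSucc_eq, h.2.2.2.1 j hj]

theorem alignedOrbit_eq
    {x : EuclideanSpace ℝ (Fin d)} {z : Fin (m + 1) → EuclideanSpace ℝ (Fin d)}
    (h : IsAligned ℓ J x z) (huniq : ∀ x' z', IsAligned ℓ J x' z' → x' = x ∧ z' = z)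
    (G : Subgroup (EuclideanSpace ℝ (Fin d) ≃ₗᵢ[ℝ] EuclideanSpace ℝ (Fin d))) :
    alignedOrbit G ℓ J = {w | ∃ A ∈ G, w = fun i => A (z i)} := by
  ext w
  constructor
  · rintro ⟨x', z', h', A, hA, rfl⟩
    obtain ⟨-, rfl⟩ := huniq x' z' h'
    exact ⟨A, hA, rfl⟩
  · rintro ⟨A, hA, rfl⟩
    exact ⟨x, z, h, A, hA, rfl⟩

end Aligned

/-! ### The orbits under O(d-1) and SO(d-1) -/

section Orbits

variable {L : Fin (m + 1) → ℝ} {c s : ℝ} {ε : Fin m → ℝ} {κ : ℝ}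
  {z : Fin (m + 1) → EuclideanSpace ℝ (Fin d)}

theorem orthFix_orbit_eq (hz : z ∈ alignedSet L c s ε (e₁ d) κ) :
    {w | ∃ A ∈ orthFix d, w = fun i => A (z i)} = alignedSet L c s ε (e₁ d) κ := by
  ext w
  constructor
  · rintro ⟨A, hA, rfl⟩
    exact map_mem_alignedSet hz A hA
  · intro hw
    obtain ⟨A, hA, hAw, -⟩ := exists_isometry_map_eq hw hz
    exact ⟨A, hA, hAw⟩

/-- If `z` lies in a coordinate plane and there is a third coordinate, rotations suffice. -/
theorem rotFix_orbit_eq (hd : 3 ≤ d) (hz : z ∈ alignedSet L c s ε (e₁ d) κ)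
    (hplane : ∀ (j : Fin d), 2 ≤ (j : ℕ) → ∀ i, z i j = 0) :
    {w | ∃ A ∈ rotFix d, w = fun i => A (z i)} = alignedSet L c s ε (e₁ d) κ := by
  ext w
  constructor
  · rintro ⟨A, hA, rfl⟩
    exact map_mem_alignedSet hz A hA.1
  · intro hw
    obtain ⟨A, hA, hAw, rfl | hdet⟩ := exists_isometry_map_eq hw hz
    · exact ⟨1, one_mem _, hAw⟩
    -- A first reflection in the third coordinate fixes e and every link of z, and changes the
    -- determinant from -1 to 1.
    · let v : EuclideanSpace ℝ (Fin d) := EuclideanSpace.single ⟨2, hd⟩ 1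
      have hv : v ≠ 0 := by
        rw [← norm_ne_zero_iff]
        simp [v]
      have hfix : ∀ x : EuclideanSpace ℝ (Fin d), x ⟨2, hd⟩ = 0 → (ℝ ∙ v)ᗮ.reflection x = x := by
        intro x hx
        apply Submodule.reflection_mem_subspace_eq_self
        rw [Submodule.mem_orthogonal_singleton_iff_inner_right]
        simp [v, EuclideanSpace.inner_single_left, hx]
      have he : (ℝ ∙ v)ᗮ.reflection (e₁ d) = e₁ d := by
        apply hfix
        have : (⟨2, hd⟩ : Fin d) ≠ 0 := by
          intro h
          simpa using congrArg Fin.val h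
        simp [e₁, this]
      refine ⟨A * (ℝ ∙ v)ᗮ.reflection, ⟨?_, ?_⟩, ?_⟩
      · change A ((ℝ ∙ v)ᗮ.reflection (e₁ d)) = e₁ d
        rw [he, hA]
      · change LinearEquiv.det (A.toLinearEquiv * (ℝ ∙ v)ᗮ.reflection.toLinearEquiv) = 1
        rw [map_mul, hdet, det_reflection_orthogonal_singleton hv, neg_mul_neg, one_mul]
      · rw [hAw]
        funext i
        change A (z i) = A ((ℝ ∙ v)ᗮ.reflection (z i))
        rw [hfix _ (hplane ⟨2, hd⟩ le_rfl i)]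

theorem rotFix_two_orbit_eq (z : Fin (m + 1) → EuclideanSpace ℝ (Fin 2)) :
    {w | ∃ A ∈ rotFix 2, w = fun i => A (z i)} = {z} := by
  ext w
  constructor
  · rintro ⟨A, hA, rfl⟩
    rw [eq_one_of_mem_rotFix_two hA]
    rfl
  · rintro rfl
    exact ⟨1, one_mem _, rfl⟩

/-- In the plane the aligned chains form a discrete set. -/
theorem eventually_eq_of_mem_alignedSet_two {z : Fin (m + 1) → EuclideanSpace ℝ (Fin 2)}
    (hz : z ∈ alignedSet L c s ε (e₁ 2) κ) (hneg : z (Fin.last m) 1 < 0) :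
    ∀ᶠ q in 𝓝 z, q ∈ alignedSet L c s ε (e₁ 2) κ → q ∈ ({z} : Set _) := by
  have hcont : Continuous fun q : Fin (m + 1) → EuclideanSpace ℝ (Fin 2) => q (Fin.last m) 1 := by
    fun_prop
  -- In the plane the last link has a fixed first coordinate and norm, so only the sign of its
  -- second coordinate is left, and that is locally constant at z.
  filter_upwards [hcont.continuousAt.eventually_lt continuousAt_const hneg] with q hq hmem
  refine alignedSet_ext hmem hz (eq_of_plane_of_norm le_rfl (fun j hj => ?_) (fun j hj => ?_) ?_
    hq hneg ?_)
  · exact absurd j.2 (by omega)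
  · exact absurd j.2 (by omega)
  · rw [← inner_e₁, ← inner_e₁, hmem.2.2, hz.2.2]
  · rw [hmem.2.1, hz.2.1]

end Orbits

end AlignedChains

end

theorem mainTheorem10 (m d : ℕ) [NeZero d] (hd : 2 ≤ d)
    (ℓ : Fin (m + 2) → ℝ) (hpos : ∀ i, 0 < ℓ i)
    (hdom : ∀ i, ℓ i ≤ ℓ (Fin.last (m + 1)))
    (J : Finset (Fin (m + 2)))
    (hJ : ∀ j ∈ J, (j : ℕ) < m)
    (hshort : IsShort ℓ (J ∪ {Fin.last (m + 1)}))
    (hlong : IsLong ℓ (J ∪ {(Fin.last m).castSucc, Fin.last (m + 1)})) :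
    (∃! x : EuclideanSpace ℝ (Fin d), ∃ z, IsAligned ℓ J x z) ∧
    IsMorseBottCritical (chainSpace d ℓ) (heightF d ℓ) (alignedOrbit (rotFix d) ℓ J)
      ((((m + 2 : ℕ) : ℤ) - 2) * ((d : ℤ) - 1) - 1) ((d : ℤ) - 2)
      ((((m + 2 : ℕ) : ℤ) - 3 - (J.card : ℤ)) * ((d : ℤ) - 1)) ∧
    IsMorseBottCritical (chainSpace d ℓ) (heightF d ℓ) (alignedOrbit (orthFix d) ℓ J)
      ((((m + 2 : ℕ) : ℤ) - 2) * ((d : ℤ) - 1) - 1) ((d : ℤ) - 2)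
      ((((m + 2 : ℕ) : ℤ) - 3 - (J.card : ℤ)) * ((d : ℤ) - 1)) := by
  have hb := hpos (Fin.last m).castSucc
  have hc := hpos (Fin.last (m + 1))
  obtain ⟨s, hsum⟩ : ∃ s, ∑ i : Fin m, alignedSign J i * ℓ i.castSucc.castSucc = -s :=
    ⟨_, (neg_neg _).symm⟩
  have h1 := hshort.lt_add hJ
  have h2 := hlong.neg_lt_add
  rw [hsum] at h1 h2
  have hdom' := hdom (Fin.last m).castSucc
  -- Shortness gives s > c - b, and c - b ≥ 0 since ℓ_n is maximal.
  have hs : 0 < s := by linarith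
  obtain ⟨κ, hκs⟩ : ∃ κ, s ^ 2 = ℓ (Fin.last m).castSucc ^ 2 + ℓ (Fin.last (m + 1)) ^ 2 +
      2 * ℓ (Fin.last m).castSucc * ℓ (Fin.last (m + 1)) * κ := by
    refine ⟨(s ^ 2 - ℓ (Fin.last m).castSucc ^ 2 - ℓ (Fin.last (m + 1)) ^ 2) /
      (2 * ℓ (Fin.last m).castSucc * ℓ (Fin.last (m + 1))), ?_⟩
    field_simp
    ring
  -- κ > -1 amounts to s² > (c - b)², and κ < 1 to s² < (b + c)².
  have hκ : κ ^ 2 < 1 := by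
    have hbc : 0 < 2 * ℓ (Fin.last m).castSucc * ℓ (Fin.last (m + 1)) := by positivity
    rw [sq_lt_one_iff_abs_lt_one, abs_lt]
    constructor
    · refine lt_of_mul_lt_mul_left (a := 2 * ℓ (Fin.last m).castSucc * ℓ (Fin.last (m + 1))) ?_
        hbc.le
      nlinarith
    · refine lt_of_mul_lt_mul_left (a := 2 * ℓ (Fin.last m).castSucc * ℓ (Fin.last (m + 1))) ?_
        hbc.le
      nlinarith
  obtain ⟨x, z, hxz⟩ := exists_isAligned (d := d) hd hpos hdom' hs hsum hκs hκ
  have huniq : ∀ x' z', IsAligned ℓ J x' z' → x' = x ∧ z' = z :=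
    fun x' z' h' => h'.unique hd hpos hs hsum hκs hxz
  have hz := hxz.mem_alignedSet hpos hs hsum hκs
  have hMB : ∀ S ⊆ alignedSet (fun i => ℓ i.castSucc) (ℓ (Fin.last (m + 1))) s (alignedSign J)
      (e₁ d) κ, IsClosed S → S.Nonempty → (∀ p ∈ S, ∀ᶠ q in 𝓝 p, q ∈ alignedSet
        (fun i => ℓ i.castSucc) (ℓ (Fin.last (m + 1))) s (alignedSign J) (e₁ d) κ → q ∈ S) →
      IsMorseBottCritical (chainSpace d ℓ) (heightF d ℓ) S
        ((((m + 2 : ℕ) : ℤ) - 2) * ((d : ℤ) - 1) - 1) ((d : ℤ) - 2)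
        ((((m + 2 : ℕ) : ℤ) - 3 - (J.card : ℤ)) * ((d : ℤ) - 1)) := by
    intro S hS hclosed hne hopen
    have h := isMorseBottCritical_of_subset_alignedSet (fun i => hpos _) hc hs (alignedSign_eq J)
      hsum (norm_e₁ d) hκs hκ hS hclosed hne hopen
    rw [finrank_euclideanSpace_fin, card_alignedSign_neg hJ] at h
    rw [heightF_eq]
    have hdim : ((m + 2 : ℕ) : ℤ) - 2 = m := by push_cast; ring
    have hind : ((m + 2 : ℕ) : ℤ) - 3 - (J.card : ℤ) = m - J.card - 1 := by push_cast; ring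
    rw [hdim, hind]
    exact h
  have hfull := hMB _ subset_rfl (isClosed_alignedSet _ _ _ _ _ _) ⟨z, hz⟩
    fun p _ => Eventually.of_forall fun q hq => hq
  refine ⟨⟨x, ⟨z, hxz⟩, fun x' ⟨z', h'⟩ => (huniq x' z' h').1⟩, ?_, ?_⟩
  · rw [alignedOrbit_eq hxz huniq]
    rcases hd.eq_or_lt with rfl | hd3
    · rw [rotFix_two_orbit_eq]
      refine hMB _ (singleton_subset_iff.2 hz) isClosed_singleton (singleton_nonempty z) ?_
      rintro p rfl
      exact eventually_eq_of_mem_alignedSet_two hz (hxz.last_one_neg hpos le_rfl hs hsum)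
    · rw [rotFix_orbit_eq hd3 hz fun j hj i => hxz.apply_eq_zero hpos hsum hj i]
      exact hfull
  · rw [alignedOrbit_eq hxz huniq, orthFix_orbit_eq hz]
    exact hfull
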